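/- Let $1<\alpha<2$ and consider the one-dimensional Ising model with spins $\sigma_i\in\{-1,+1\}$, $i\in\mathbb Z$, and formal Hamiltonian $$H=-(\gamma-\epsilon)\sum_i\sigma_i\sigma_{i+1}-\epsilon\sum_{j<k}\frac{\sigma_j\sigma_k}{|j-k|^\alpha}.$$ For $m\ge 1$ let $\langle\cdot\rangle_m$ be the expectation in the Gibbs measure with weights proportional to $e^{-H_m}$ on the ring $\Lambda_m=\mathbb Z/2m\mathbb Z$, where $$H_m=-(\gamma-\epsilon)\sum_{j\in\Lambda_m}\sigma_j\sigma_{j+1}-\epsilon\sum_{\{j,k\}\subset\Lambda_m,\,j\ne k}J_{j,k}\,\sigma_j\sigma_k,\qquad J_{j,k}=\sum_{n\in\mathbb Z}\frac1{|j-k+2mn|^{\alpha}}.$$ A probability measure $\mu$ on $\{-1,+1\}^{\mathbb Z}$ is called an infinite-volume limit of the periodic Gibbs measures if there is a strictly increasing sequence $m_l$ of positive integers such that $\langle\prod_{i\in A}\sigma_{i\bmod 2m_l}\rangle_{m_l}\to\int\prod_{i\in A}\sigma_i\,d\mu$ for every finite $A\subset\mathbb Z$. The model is said to have long-range order if there is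 a constant $c>0$ such that 1. for all sufficiently large $m$, $\Big\langle\Big(\frac1{2m}\sum_{j\in\Lambda_m}\sigma_j\Big)^2\Big\rangle_m\ge c$ (that is, the Fourier transform of the two-point function has an atom at the origin), and 2. infinite-volume limits of the periodic Gibbs measures exist, and for each of them, $\mu$, one has $\frac1N\sum_{n=1}^N\int\sigma_0\sigma_n\,d\mu\ge c$ for all sufficiently large $N$ (so the two-point function does not decay to $0$). **Proposition.** For every $\alpha\in(1,2)$ and every $\epsilon>0$ there is $\gamma_0=\gamma_0(\epsilon,\alpha)>0$ such that for every $\gamma>\gamma_0$ the model has long-range order. -/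

import Mathlib

open Filter Topology MeasureTheory
open scoped BigOperators

namespace DysonIsing

noncomputable section

/-- The value in `{-1, +1} ⊂ ℝ` of an Ising spin. -/
def spin (s : ℤˣ) : ℝ := ((s : ℤ) : ℝ)

/-- The periodized power law `∑_{n ∈ ℤ} |r + 2mn|^{-α}`, where `r` runs over the integers modulo
`2m` (the sum does not depend on the representative of `r`). It is used only for `r ≠ 0`, where no
term has denominator zero. -/
def periodicJ (α : ℝ) (m : ℕ) (r : ZMod (2 * m)) : ℝ :=
  ∑' n : ℤ, 1 / |(r.val : ℝ) + 2 * (m : ℝ) * (n : ℝ)| ^ α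

/-- The Hamiltonian
`-(γ - ε) ∑_j σ_j σ_{j+1} - ε ∑_{{j,k}, j ≠ k} J_{j,k} σ_j σ_k`
on the ring with `2m` sites. The factor `1/2` makes every unordered pair count once. -/
def hamiltonian (α γ ε : ℝ) (m : ℕ) [NeZero m] (σ : ZMod (2 * m) → ℤˣ) : ℝ :=
  -(γ - ε) * ∑ j, spin (σ j) * spin (σ (j + 1))
    - ε * ((1 / 2) * ∑ j, ∑ k ∈ Finset.univ.erase j,
        periodicJ α m (j - k) * (spin (σ j) * spin (σ k)))

/-- The expectation of `f` in the Gibbs measure on the ring with `2m` sites, whose weights are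
proportional to `exp (-H)` (inverse temperature is absorbed in `γ` and `ε`). -/
def gibbsExp (α γ ε : ℝ) (m : ℕ) [NeZero m] (f : (ZMod (2 * m) → ℤˣ) → ℝ) : ℝ :=
  (∑ σ, f σ * Real.exp (-hamiltonian α γ ε m σ)) /
    ∑ σ, Real.exp (-hamiltonian α γ ε m σ)

/-- The zero-momentum part of the two-point function per site,
`⟨((2m)⁻¹ ∑_j σ_j)²⟩ = (2m)⁻² ∑_{j,k} ⟨σ_j σ_k⟩ = g_m(0) / (2m)`. -/
def orderParameter (α γ ε : ℝ) (m : ℕ) [NeZero m] : ℝ :=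
  gibbsExp α γ ε m fun σ => ((1 / (2 * (m : ℝ))) * ∑ j, spin (σ j)) ^ 2

/-- `μ` is an infinite-volume limit of the periodic Gibbs measures: along some sequence of rings
of growing size all correlation functions converge to those of `μ`. (Monomials in the spins span
all local observables, so this is weak convergence.) -/
def IsPeriodicLimit (α γ ε : ℝ) (μ : Measure (ℤ → ℤˣ)) : Prop :=
  ∃ (φ : ℕ → ℕ) (_ : ∀ l, NeZero (φ l)), StrictMono φ ∧
    ∀ A : Finset ℤ,
      Tendsto (fun l => gibbsExp α γ ε (φ l) fun σ => ∏ i ∈ A, spin (σ (i : ZMod (2 * φ l))))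
        atTop (𝓝 (∫ ω, ∏ i ∈ A, spin (ω i) ∂μ))

/-- Long-range order: the two-point function has an atom at zero momentum, along the periodic
finite-volume Gibbs measures and in every infinite-volume limit of them (of which there is at
least one). -/
def HasLongRangeOrder (α γ ε : ℝ) : Prop :=
  ∃ c : ℝ, 0 < c ∧
    (∃ m₀ : ℕ, ∀ (m : ℕ) [NeZero m], m₀ ≤ m → c ≤ orderParameter α γ ε m) ∧
    (∃ μ : Measure (ℤ → ℤˣ), IsProbabilityMeasure μ ∧ IsPeriodicLimit α γ ε μ) ∧
    ∀ μ : Measure (ℤ → ℤˣ), IsProbabilityMeasure μ → IsPeriodicLimit α γ ε μ →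
      ∃ N₀ : ℕ, ∀ N : ℕ, N₀ ≤ N →
        c ≤ (1 / (N : ℝ)) * ∑ n ∈ Finset.Icc 1 N, ∫ ω, spin (ω 0) * spin (ω (n : ℤ)) ∂μ

end

end DysonIsing

namespace DysonIsing

noncomputable section

/-! The argument is the reflection positivity route to an infrared bound. On the ring the Gibbs
weight is, up to a constant, `exp (-gradEnergy J σ)`. The reflection `j ↦ -1 - j` couples the two
halves through the matrix `J (i + j + 1)`, which is positive semidefinite: the nearest-neighbour
part is a sum of two rank-one terms, and the power law is a Laplace transform of a positive measure
(`reflectionPositive_ringCoupling`).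

A Schwarz inequality then shows that reflecting either half of a shift field `h` does not decrease
the partition function on geometric average, so repeated reflection flattens `h` and gives `Z(h) ≤
Z(0)` (`shiftedPartition_le`). To second order in `h` this reads `⟨|σ̂(p)|²⟩ ≤ 2m / E(p)` for `p ≠
0`, where `E` is the dispersion relation (`gibbsSum_structureFactor_le`).

By Parseval, `1 - ⟨σ_j σ_k⟩` is an average of `⟨|σ̂(p)|²⟩` with weights `1 - cos (p (k - j))`. The
weight vanishes at `p = 0` and is at most `2`, so `1 - ⟨σ_j σ_k⟩ ≤ (1/m) ∑_{p ≠ 0} 1 / E(p)` for all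
`j` and `k`.

With momentum `π x`, `0 < x ≤ 1`, `E` is at least of order `ε x^(α-1) + (γ - ε) x²`. The first term
makes `1 / E` integrable in one dimension because `α < 2`; the second makes the integral small for
large `γ`. Interpolating between them bounds the sum by a constant times a negative power of `γ -
ε`, uniformly in `m` (`sum_one_div_dispersion_le`). Hence all two-point functions are at least `1/2`
for large `γ`. This bound passes to the spatial average and to infinite-volume limits, which exist
by compactness. -/

/-! ### Entrywise functions of positive semidefinite matrices and a Schwarz inequality -/

/-- Schur product theorem, iterated from the all-ones matrix, which has rank one. -/
theorem posSemidef_map_pow {ι : Type*} [Fintype ι] {M : Matrix ι ι ℝ} (hM : M.PosSemidef) (n : ℕ) :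
    (M.map fun x => x ^ n).PosSemidef := by
  classical
  induction n with
  | zero =>
    have h := Matrix.posSemidef_vecMulVec_self_star (R := ℝ) (fun _ : ι => (1 : ℝ))
    convert h using 1
    ext i j
    simp [Matrix.vecMulVec]
  | succ n ih =>
    have h : (M.map fun x => x ^ (n + 1)) = (M.map fun x => x ^ n).hadamard M := by
      ext i j
      simp [pow_succ]
    rw [h]
    exact ih.hadamard hM

/-- The exponential series has nonnegative coefficients, and each entrywise power is positive
semidefinite. -/
theorem posSemidef_map_exp {ι : Type*} [Fintype ι] {M : Matrix ι ι ℝ} (hM : M.PosSemidef) :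
    (M.map Real.exp).PosSemidef := by
  refine Matrix.PosSemidef.of_dotProduct_mulVec_nonneg ?_ fun c => ?_
  · ext i j
    have := hM.isHermitian.apply i j
    simp only [star_trivial] at this
    simp [this]
  · have hlim : Tendsto (fun N : ℕ => ∑ n ∈ Finset.range N,
        ((n.factorial : ℝ)⁻¹ * (star c ⬝ᵥ (M.map fun x => x ^ n).mulVec c))) atTop
        (𝓝 (star c ⬝ᵥ (M.map Real.exp).mulVec c)) := by
      have h : HasSum (fun n : ℕ => (n.factorial : ℝ)⁻¹ * (star c ⬝ᵥ (M.map fun x => x ^ n).mulVec c))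
          (star c ⬝ᵥ (M.map Real.exp).mulVec c) := by
        simp only [dotProduct, Matrix.mulVec, Matrix.map_apply, Finset.mul_sum]
        refine hasSum_sum fun i _ => hasSum_sum fun j _ => ?_
        have h1 : HasSum (fun n : ℕ => (M i j) ^ n / n.factorial) (Real.exp (M i j)) := by
          rw [Real.exp_eq_exp_ℝ]
          exact NormedSpace.expSeries_div_hasSum_exp (M i j)
        have h2 := (h1.mul_right (c j)).mul_left (star c i)
        have h3 : ∀ n : ℕ, (n.factorial : ℝ)⁻¹ * (star c i * ((M i j) ^ n * c j)) =
            star c i * ((M i j) ^ n / n.factorial * c j) := fun n => by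
          rw [div_eq_mul_inv]
          ring
        exact (funext h3).symm ▸ h2
      exact h.tendsto_sum_nat
    refine ge_of_tendsto' hlim fun N => Finset.sum_nonneg fun n _ => ?_
    have := (posSemidef_map_pow hM n).dotProduct_mulVec_nonneg c
    positivity

theorem sq_sum_mul_le_of_posSemidef {ι : Type*} [Fintype ι] {M : Matrix ι ι ℝ}
    (hM : M.PosSemidef) (u v : ι → ℝ) :
    (∑ a, ∑ b, u a * v b * M a b) ^ 2 ≤
      (∑ a, ∑ b, u a * u b * M a b) * ∑ a, ∑ b, v a * v b * M a b := by
  classical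
  have key : ∀ x y : ι → ℝ, Matrix.toBilin' M x y = ∑ a, ∑ b, x a * y b * M a b := by
    intro x y
    rw [Matrix.toBilin'_apply]
    exact Finset.sum_congr rfl fun _ _ => Finset.sum_congr rfl fun _ _ => by ring
  have hs : ∀ x y : ι → ℝ, Matrix.toBilin' M x y = Matrix.toBilin' M y x := by
    intro x y
    rw [key, key, Finset.sum_comm]
    refine Finset.sum_congr rfl fun i _ => Finset.sum_congr rfl fun j _ => ?_
    have := hM.isHermitian.apply i j
    simp only [star_trivial] at this
    rw [this]; ring
  have hp : ∀ x : ι → ℝ, 0 ≤ Matrix.toBilin' M x x := by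
    intro x
    have := hM.dotProduct_mulVec_nonneg x
    rw [Matrix.toBilin'_apply']
    simpa using this
  have := LinearMap.BilinForm.apply_mul_apply_le_of_forall_zero_le (Matrix.toBilin' M) hp u v
  rw [hs v u, key, key, key] at this
  rw [sq]
  exact this

/-- The Schwarz inequality behind reflection positivity. -/
theorem sq_sum_exp_le {L A B : Type*} [Fintype L] [Fintype A] [Fintype B] {K : Matrix L L ℝ}
    (hK : K.PosSemidef) (x : A → L → ℝ) (y : B → L → ℝ) (F : A → ℝ) (G : B → ℝ) :
    (∑ a, ∑ b, F a * G b * Real.exp (∑ i, ∑ j, K i j * (x a i * y b j))) ^ 2 ≤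
      (∑ a, ∑ b, F a * F b * Real.exp (∑ i, ∑ j, K i j * (x a i * x b j))) *
        ∑ a, ∑ b, G a * G b * Real.exp (∑ i, ∑ j, K i j * (y a i * y b j)) := by
  -- The configurations of both families are stacked as rows of one matrix `z`, so that `z K zᵀ`
  -- contains all the exponents. Cauchy–Schwarz for its entrywise exponential is applied to `F`
  -- supported on `A` and `G` supported on `B`.
  let z : Matrix (A ⊕ B) L ℝ := Matrix.of (Sum.elim x y)
  have hM := posSemidef_map_exp (hK.mul_mul_conjTranspose_same z)
  have hz : ∀ c d, (z * K * z.conjTranspose) c d =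
      ∑ i, ∑ j, K i j * (z c i * z d j) := by
    intro c d
    simp only [Matrix.mul_apply, Matrix.conjTranspose_apply, star_trivial, Finset.sum_mul]
    rw [Finset.sum_comm]
    exact Finset.sum_congr rfl fun _ _ => Finset.sum_congr rfl fun _ _ => by ring
  have h := sq_sum_mul_le_of_posSemidef hM (Sum.elim F fun _ => 0) (Sum.elim (fun _ => 0) G)
  simp only [Matrix.map_apply, hz, Fintype.sum_sum_type, Sum.elim_inl, Sum.elim_inr, zero_mul,
    mul_zero, Finset.sum_const_zero, add_zero, zero_add] at h
  exact h

/-! ### Gradient energy and shifted partition functions -/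

theorem spin_sq (s : ℤˣ) : spin s ^ 2 = 1 := by
  rcases Int.units_eq_one_or s with h | h <;> simp [spin, h]

theorem spin_mul_self (s : ℤˣ) : spin s * spin s = 1 := by rw [← sq, spin_sq]

/-- The energy `½ ∑_{{j,k}} J(j - k) (s_j - s_k)²` of a real configuration on the ring. -/
def gradEnergy {N : ℕ} [NeZero N] (J : ZMod N → ℝ) (s : ZMod N → ℝ) : ℝ :=
  (1 / 4) * ∑ j, ∑ k, J (j - k) * (s j - s k) ^ 2

/-- The partition function in which the spins are shifted by `h`. -/
def shiftedPartition {N : ℕ} [NeZero N] (J : ZMod N → ℝ) (h : ZMod N → ℝ) : ℝ :=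
  ∑ σ : ZMod N → ℤˣ, Real.exp (-gradEnergy J fun j => spin (σ j) + h j)

theorem shiftedPartition_pos {N : ℕ} [NeZero N] (J h : ZMod N → ℝ) :
    0 < shiftedPartition J h :=
  Finset.sum_pos (fun _ _ => Real.exp_pos _) Finset.univ_nonempty

theorem gradEnergy_translate {N : ℕ} [NeZero N] (J s : ZMod N → ℝ) (a : ZMod N) :
    gradEnergy J (fun j => s (j + a)) = gradEnergy J s := by
  unfold gradEnergy
  congr 1
  refine Fintype.sum_equiv (Equiv.addRight a) _ _ fun j => ?_
  refine Fintype.sum_equiv (Equiv.addRight a) _ _ fun k => ?_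
  simp

theorem shiftedPartition_translate {N : ℕ} [NeZero N] (J h : ZMod N → ℝ) (a : ZMod N) :
    shiftedPartition J (fun j => h (j + a)) = shiftedPartition J h := by
  unfold shiftedPartition
  refine Fintype.sum_equiv ((Equiv.addRight a).arrowCongr (Equiv.refl ℤˣ)) _ _ fun σ => ?_
  rw [← gradEnergy_translate J (fun j => spin _ + h j) a]
  simp

theorem shiftedPartition_const {N : ℕ} [NeZero N] (J : ZMod N → ℝ) (c : ℝ) :
    shiftedPartition J (fun _ => c) = shiftedPartition J 0 := by
  simp [shiftedPartition, gradEnergy]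

/-! ### Reflecting the ring between sites -/

/-- The two halves of the ring, the second one being the mirror image of the first. -/
def halves (m : ℕ) [NeZero m] : Fin m ⊕ Fin m ≃ ZMod (2 * m) :=
  Equiv.ofBijective (Sum.elim (fun i => ((i : ℕ) : ZMod (2 * m))) fun i => -1 - ((i : ℕ) : ZMod (2 * m)))
    (by
      rw [Fintype.bijective_iff_injective_and_card]
      refine ⟨?_, by simp [ZMod.card]; ring⟩
      have key : ∀ i : Fin m, (-1 - ((i : ℕ) : ZMod (2 * m))) = ((2 * m - 1 - i : ℕ) : ZMod (2 * m)) := by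
        intro i
        have := i.2
        rw [Nat.sub_sub, Nat.cast_sub (by omega)]
        simp
        ring
      rintro (i | i) (j | j) h
      all_goals
        have hi := i.2
        have hj := j.2
        simp only [Sum.elim_inl, Sum.elim_inr, key] at h
        rw [ZMod.natCast_eq_natCast_iff', Nat.mod_eq_of_lt (by omega), Nat.mod_eq_of_lt (by omega)] at h
      · exact congrArg _ (Fin.ext h)
      · omega
      · omega
      · exact congrArg _ (Fin.ext (by omega)))

theorem halves_inl {m : ℕ} [NeZero m] (i : Fin m) :
    halves m (.inl i) = ((i : ℕ) : ZMod (2 * m)) := rfl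

theorem halves_inr {m : ℕ} [NeZero m] (i : Fin m) :
    halves m (.inr i) = -1 - ((i : ℕ) : ZMod (2 * m)) := rfl

theorem sum_halves {m : ℕ} [NeZero m] (f : ZMod (2 * m) → ℝ) :
    ∑ j, f j = ∑ i, f (halves m (.inl i)) + ∑ i, f (halves m (.inr i)) := by
  rw [← (halves m).sum_comp, Fintype.sum_sum_type]

/-- The coupling between a site in the first half and a mirrored site in the second half. -/
def crossCoupling {m : ℕ} (J : ZMod (2 * m) → ℝ) : Matrix (Fin m) (Fin m) ℝ :=
  Matrix.of fun i j => J (((i : ℕ) : ZMod (2 * m)) + ((j : ℕ) : ZMod (2 * m)) + 1)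

/-- A coupling on the ring that is even and reflection positive. -/
structure ReflectionPositive {m : ℕ} (J : ZMod (2 * m) → ℝ) : Prop where
  even : ∀ r, J (-r) = J r
  posSemidef : (crossCoupling J).PosSemidef

/-- The energy of one half of the ring, with the diagonal part of the coupling across. -/
def halfEnergy {m : ℕ} (J : ZMod (2 * m) → ℝ) (x : Fin m → ℝ) : ℝ :=
  (1 / 4) * ∑ i : Fin m, ∑ j : Fin m,
      J (((i : ℕ) : ZMod (2 * m)) - ((j : ℕ) : ZMod (2 * m))) * (x i - x j) ^ 2
    + (1 / 2) * ∑ i, ∑ j, crossCoupling J i j * x i ^ 2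

/-- Expanding the squares across the cut leaves terms depending on one half only, and a bilinear
term. Since `J` is even, both halves get the same energy function. In `exp (-gradEnergy)` the
bilinear term enters with a plus sign, the form required by `sq_sum_exp_le`. -/
theorem gradEnergy_halves {m : ℕ} [NeZero m] {J : ZMod (2 * m) → ℝ} (hJ : ∀ r, J (-r) = J r)
    (s : ZMod (2 * m) → ℝ) :
    gradEnergy J s = halfEnergy J (fun i => s (halves m (.inl i)))
      + halfEnergy J (fun i => s (halves m (.inr i)))
      - ∑ i, ∑ j, crossCoupling J i j * (s (halves m (.inl i)) * s (halves m (.inr j))) := by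
  have hc : ∀ i j, crossCoupling J i j = crossCoupling J j i := by
    intro i j
    simp only [crossCoupling, Matrix.of_apply]
    congr 1
    ring
  have h0 : ∀ i j : Fin m, J (halves m (.inl i) - halves m (.inl j)) =
      J (((i : ℕ) : ZMod (2 * m)) - ((j : ℕ) : ZMod (2 * m))) := fun i j => rfl
  have h1 : ∀ i j : Fin m, J (halves m (.inl i) - halves m (.inr j)) = crossCoupling J i j := by
    intro i j
    simp only [crossCoupling, Matrix.of_apply, halves_inl, halves_inr]
    congr 1
    ring
  have h2 : ∀ i j : Fin m, J (halves m (.inr i) - halves m (.inl j)) = crossCoupling J i j := by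
    intro i j
    simp only [crossCoupling, Matrix.of_apply, halves_inl, halves_inr]
    rw [← hJ]
    congr 1
    ring
  have h3 : ∀ i j : Fin m, J (halves m (.inr i) - halves m (.inr j)) =
      J (((i : ℕ) : ZMod (2 * m)) - ((j : ℕ) : ZMod (2 * m))) := by
    intro i j
    simp only [halves_inr]
    rw [← hJ]
    congr 1
    ring
  set x := fun i => s (halves m (.inl i)) with hx
  set y := fun i => s (halves m (.inr i)) with hy
  have e1 : ∑ i, ∑ j, crossCoupling J i j * (x i - y j) ^ 2 =
      ∑ i, ∑ j, crossCoupling J i j * x i ^ 2 + ∑ i, ∑ j, crossCoupling J i j * y i ^ 2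
        - 2 * ∑ i, ∑ j, crossCoupling J i j * (x i * y j) := by
    have : ∑ i, ∑ j, crossCoupling J i j * y i ^ 2 = ∑ i, ∑ j, crossCoupling J i j * y j ^ 2 := by
      rw [Finset.sum_comm]
      exact Finset.sum_congr rfl fun i _ => Finset.sum_congr rfl fun j _ => by rw [hc]
    rw [this]
    simp only [Finset.mul_sum, ← Finset.sum_add_distrib, ← Finset.sum_sub_distrib]
    exact Finset.sum_congr rfl fun i _ => Finset.sum_congr rfl fun j _ => by ring
  have e2 : ∑ i, ∑ j, crossCoupling J i j * (y i - x j) ^ 2 =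
      ∑ i, ∑ j, crossCoupling J i j * (x i - y j) ^ 2 := by
    rw [Finset.sum_comm]
    exact Finset.sum_congr rfl fun i _ => Finset.sum_congr rfl fun j _ => by rw [hc]; ring
  have e3 : ∑ j, ∑ k, J (j - k) * (s j - s k) ^ 2 =
      ∑ i : Fin m, ∑ j : Fin m,
        J (((i : ℕ) : ZMod (2 * m)) - ((j : ℕ) : ZMod (2 * m))) * (x i - x j) ^ 2
      + ∑ i, ∑ j, crossCoupling J i j * (x i - y j) ^ 2
      + ∑ i, ∑ j, crossCoupling J i j * (y i - x j) ^ 2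
      + ∑ i : Fin m, ∑ j : Fin m,
        J (((i : ℕ) : ZMod (2 * m)) - ((j : ℕ) : ZMod (2 * m))) * (y i - y j) ^ 2 := by
    simp only [sum_halves, Finset.sum_add_distrib, h0, h1, h2, h3, hx, hy]
    ring
  rw [gradEnergy, e3, e2, e1, halfEnergy, halfEnergy]
  ring

/-- Configurations on the ring as pairs of configurations on its halves. -/
def splitConfig (m : ℕ) [NeZero m] (S : Type*) :
    (ZMod (2 * m) → S) ≃ (Fin m → S) × (Fin m → S) :=
  ((halves m).symm.arrowCongr (Equiv.refl S)).trans (Equiv.sumArrowEquivProdArrow _ _ _)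

theorem sum_splitConfig {m : ℕ} [NeZero m] {S : Type*} [Fintype S]
    (f : (Fin m → S) → (Fin m → S) → ℝ) :
    ∑ σ : ZMod (2 * m) → S, f (fun i => σ (halves m (.inl i))) (fun i => σ (halves m (.inr i))) =
      ∑ a, ∑ b, f a b := by
  rw [← Fintype.sum_prod_type']
  exact Fintype.sum_equiv (splitConfig m S) _ _ fun σ => rfl

theorem shiftedPartition_halves {m : ℕ} [NeZero m] {J : ZMod (2 * m) → ℝ}
    (hJ : ∀ r, J (-r) = J r) (h : ZMod (2 * m) → ℝ) (p q : Fin m → ℝ)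
    (hp : ∀ i, h (halves m (.inl i)) = p i) (hq : ∀ i, h (halves m (.inr i)) = q i) :
    shiftedPartition J h = ∑ a : Fin m → ℤˣ, ∑ b : Fin m → ℤˣ,
      Real.exp (-halfEnergy J fun i => spin (a i) + p i) *
      Real.exp (-halfEnergy J fun i => spin (b i) + q i) *
      Real.exp (∑ i, ∑ j, crossCoupling J i j * ((spin (a i) + p i) * (spin (b j) + q j))) := by
  rw [← sum_splitConfig (m := m) (S := ℤˣ), shiftedPartition]
  refine Finset.sum_congr rfl fun σ _ => ?_
  rw [← Real.exp_add, ← Real.exp_add, gradEnergy_halves hJ]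
  simp only [hp, hq]
  congr 1
  ring

/-- The mirror image `j ↦ -1 - j` extends the values of `h` on the first half. -/
def reflectLeft {m : ℕ} [NeZero m] (h : ZMod (2 * m) → ℝ) (j : ZMod (2 * m)) : ℝ :=
  if j.val < m then h j else h (-1 - j)

/-- The mirror image `j ↦ -1 - j` extends the values of `h` on the second half. -/
def reflectRight {m : ℕ} [NeZero m] (h : ZMod (2 * m) → ℝ) (j : ZMod (2 * m)) : ℝ :=
  if j.val < m then h (-1 - j) else h j

theorem val_halves_inl {m : ℕ} [NeZero m] (i : Fin m) : (halves m (.inl i)).val < m := by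
  have := i.2
  rw [halves_inl, ZMod.val_natCast, Nat.mod_eq_of_lt (by omega)]
  exact this

theorem val_neg_one_sub {m : ℕ} [NeZero m] (j : ZMod (2 * m)) :
    (-1 - j).val = 2 * m - 1 - j.val := by
  have hj := ZMod.val_lt j
  have : (-1 - j) = ((2 * m - 1 - j.val : ℕ) : ZMod (2 * m)) := by
    rw [Nat.sub_sub, Nat.cast_sub (by omega)]
    simp
    ring
  rw [this, ZMod.val_natCast, Nat.mod_eq_of_lt (by omega)]

theorem val_halves_inr {m : ℕ} [NeZero m] (i : Fin m) : ¬ (halves m (.inr i)).val < m := by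
  have := val_halves_inl i
  rw [halves_inr, ← halves_inl, val_neg_one_sub]
  omega

/-- The two factors given by `sq_sum_exp_le` use the same half of `h` on both sides of the cut, and
so are the partition functions of the two reflected fields. -/
theorem sq_shiftedPartition_le {m : ℕ} [NeZero m] {J : ZMod (2 * m) → ℝ}
    (hJ : ReflectionPositive J) (h : ZMod (2 * m) → ℝ) :
    shiftedPartition J h ^ 2 ≤
      shiftedPartition J (reflectLeft h) * shiftedPartition J (reflectRight h) := by
  have hr : ∀ i : Fin m, -1 - halves m (.inl i) = halves m (.inr i) := fun i => by
    rw [halves_inl, halves_inr]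
  have hl : ∀ i : Fin m, -1 - halves m (.inr i) = halves m (.inl i) := fun i => by
    rw [halves_inl, halves_inr]; ring
  rw [shiftedPartition_halves hJ.even h (fun i => h (halves m (.inl i)))
      (fun i => h (halves m (.inr i))) (fun _ => rfl) (fun _ => rfl),
    shiftedPartition_halves hJ.even (reflectLeft h) (fun i => h (halves m (.inl i)))
      (fun i => h (halves m (.inl i))) (fun i => by simp [reflectLeft, val_halves_inl])
      (fun i => by simp only [reflectLeft, val_halves_inr, hl, if_false]),
    shiftedPartition_halves hJ.even (reflectRight h) (fun i => h (halves m (.inr i)))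
      (fun i => h (halves m (.inr i)))
      (fun i => by simp only [reflectRight, val_halves_inl, hr, if_true])
      (fun i => by simp [reflectRight, val_halves_inr])]
  exact sq_sum_exp_le hJ.posSemidef _ _ _ _

/-! ### Gaussian domination by repeated reflection -/

/-- The number of bonds along which `h` is constant. -/
def flatBonds {N : ℕ} [NeZero N] (h : ZMod N → ℝ) : ℕ :=
  ∑ j, if h j = h (j + 1) then 1 else 0

theorem flatBonds_translate {N : ℕ} [NeZero N] (h : ZMod N → ℝ) (a : ZMod N) :
    flatBonds (fun j => h (j + a)) = flatBonds h := by
  unfold flatBonds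
  refine Fintype.sum_equiv (Equiv.addRight a) _ _ fun j => ?_
  simp only [Equiv.coe_addRight, add_right_comm j 1 a]
  congr

/-- A bond inside one half is copied to its mirror image in exactly one of the two reflected fields,
so such bonds balance. Bonds across the cut become flat in both fields, and the bond from `-1` to
`0` was not flat. -/
theorem flatBonds_reflect {m : ℕ} [NeZero m] (h : ZMod (2 * m) → ℝ) (hne : h (-1) ≠ h 0) :
    2 * flatBonds h < flatBonds (reflectLeft h) + flatBonds (reflectRight h) := by
  have hm : 0 < m := Nat.pos_of_ne_zero (NeZero.ne m)
  -- Each bond is paired with its mirror image: `j ↦ -2 - j` carries the bond starting at `j` to the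
  -- one starting at `-2 - j`.
  have h2 : 2 * flatBonds h = ∑ j : ZMod (2 * m), ((if h j = h (j + 1) then 1 else 0) +
      if h (-1 - j) = h (-2 - j) then 1 else 0) := by
    rw [Finset.sum_add_distrib, two_mul]
    congr 1
    unfold flatBonds
    refine Fintype.sum_equiv (Equiv.subLeft (-2)) _ _ fun j => ?_
    have e1 : -1 - ((-2 : ZMod (2 * m)) - j) = j + 1 := by ring
    have e2 : -2 - ((-2 : ZMod (2 * m)) - j) = j := by ring
    simp only [Equiv.subLeft_apply, e1, e2, eq_comm]
  rw [h2]
  unfold flatBonds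
  rw [← Finset.sum_add_distrib]
  -- A bond joining the two halves is its own mirror image. The wrap-around bond is treated
  -- separately because `val` jumps there.
  have hcross : ∀ j : ZMod (2 * m), ¬ (j.val < m ↔ (j + 1).val < m) → j + 1 = -1 - j := by
    intro j hj
    have hlt := ZMod.val_lt j
    apply ZMod.val_injective
    rw [val_neg_one_sub]
    rcases eq_or_ne (j.val + 1) (2 * m) with hv | hv
    · have h0 : j + 1 = 0 := by
        rw [← ZMod.natCast_zmod_val j, ← Nat.cast_one, ← Nat.cast_add, hv]
        simp
      rw [h0, ZMod.val_zero] at hj ⊢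
      omega
    · have h0 : (j + 1).val = j.val + 1 := by
        rw [← ZMod.natCast_zmod_val j, ← Nat.cast_one, ← Nat.cast_add, ZMod.val_natCast,
          ZMod.val_natCast, Nat.mod_eq_of_lt hlt, Nat.mod_eq_of_lt (by omega)]
      omega
  have hcross' : ∀ j : ZMod (2 * m), ¬ (j.val < m ↔ (j + 1).val < m) →
      reflectLeft h j = reflectLeft h (j + 1) ∧ reflectRight h j = reflectRight h (j + 1) := by
    intro j hj
    have h1 := hcross j hj
    have h3 : -1 - (j + 1) = j := by rw [h1]; ring
    unfold reflectLeft reflectRight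
    rw [h3]
    by_cases ha : j.val < m <;> by_cases hb : (j + 1).val < m
    · exact absurd (iff_of_true ha hb) hj
    · simp only [ha, hb, if_true, if_false, ← h1, and_self]
    · simp only [ha, hb, if_true, if_false, ← h1, and_self]
    · exact absurd (iff_of_false ha hb) hj
  refine Finset.sum_lt_sum (fun j _ => ?_) ⟨-1, Finset.mem_univ _, ?_⟩
  · by_cases hj : j.val < m ↔ (j + 1).val < m
    · have h3 : -1 - (j + 1) = -2 - j := by ring
      unfold reflectLeft reflectRight
      by_cases ha : j.val < m
      · simp only [ha, hj.1 ha, if_true, h3]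
        rfl
      · have hb : ¬ (j + 1).val < m := fun hb => ha (hj.2 hb)
        simp only [ha, hb, if_false, h3]
        rw [add_comm]
    · simp only [hcross' j hj, if_true]
      split_ifs <;> simp
  · have hj : ¬ ((-1 : ZMod (2 * m)).val < m ↔ ((-1 : ZMod (2 * m)) + 1).val < m) := by
      have := val_neg_one_sub (0 : ZMod (2 * m))
      rw [sub_zero, ZMod.val_zero] at this
      rw [this, neg_add_cancel, ZMod.val_zero]
      omega
    have e : (-2 : ZMod (2 * m)) - -1 = -1 := by ring
    simp only [hcross' _ hj, if_true, neg_add_cancel, hne, if_false, e, sub_self, Ne.symm hne]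
    norm_num

/-- Gaussian domination. -/
theorem shiftedPartition_le {m : ℕ} [NeZero m] {J : ZMod (2 * m) → ℝ}
    (hJ : ReflectionPositive J) (h : ZMod (2 * m) → ℝ) :
    shiftedPartition J h ≤ shiftedPartition J 0 := by
  classical
  -- Fields with values in the range of `h` form a finite set stable under translation and
  -- reflection, so a maximizer exists without any decay argument.
  let T : Finset (ZMod (2 * m) → ℝ) := Fintype.piFinset fun _ => Finset.univ.image h
  have hT : ∀ g, g ∈ T ↔ ∀ j, ∃ k, h k = g j := by simp [T, Fintype.mem_piFinset]
  have hhT : h ∈ T := (hT h).2 fun j => ⟨j, rfl⟩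
  obtain ⟨g₀, hg₀, hmax⟩ := T.exists_max_image (shiftedPartition J) ⟨h, hhT⟩
  -- Among the maximizers, one with the most flat bonds is chosen. If some bond were not flat,
  -- translating it to the cut and reflecting would produce a maximizer with more flat bonds.
  obtain ⟨g, hg, hgmax⟩ := (T.filter fun g => shiftedPartition J g = shiftedPartition J g₀).exists_max_image
    flatBonds ⟨g₀, by simp [hg₀]⟩
  rw [Finset.mem_filter] at hg
  have hflat : ∀ j, g j = g (j + 1) := by
    by_contra! hcon
    obtain ⟨j, hj⟩ := hcon
    let f : ZMod (2 * m) → ℝ := fun i => g (i + (j + 1))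
    have hfZ : shiftedPartition J f = shiftedPartition J g₀ := by
      rw [← hg.2]; exact shiftedPartition_translate J g (j + 1)
    have hfT : ∀ i, ∃ k, h k = f i := fun i => (hT g).1 hg.1 _
    have hL : reflectLeft f ∈ T := (hT _).2 fun i => by
      unfold reflectLeft; split_ifs <;> exact hfT _
    have hR : reflectRight f ∈ T := (hT _).2 fun i => by
      unfold reflectRight; split_ifs <;> exact hfT _
    have hsq := sq_shiftedPartition_le hJ f
    rw [hfZ] at hsq
    have h0 := shiftedPartition_pos J g₀
    have hl0 := shiftedPartition_pos J (reflectLeft f)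
    have hr0 := shiftedPartition_pos J (reflectRight f)
    have hlm := hmax _ hL
    have hrm := hmax _ hR
    -- Two positive numbers at most `Z_max` whose product is at least `Z_max²` both equal `Z_max`.
    have hle : shiftedPartition J (reflectLeft f) = shiftedPartition J g₀ := by nlinarith
    have hre : shiftedPartition J (reflectRight f) = shiftedPartition J g₀ := by nlinarith
    have b1 := hgmax _ (Finset.mem_filter.2 ⟨hL, hle⟩)
    have b2 := hgmax _ (Finset.mem_filter.2 ⟨hR, hre⟩)
    have b3 := flatBonds_reflect f (by
      have : (-1 : ZMod (2 * m)) + (j + 1) = j := by ring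
      simpa [f, this] using hj)
    have b4 : flatBonds f = flatBonds g := flatBonds_translate g (j + 1)
    omega
  have hconst : ∀ n : ℕ, g (n : ZMod (2 * m)) = g 0 := by
    intro n
    induction n with
    | zero => simp
    | succ n ih => rw [Nat.cast_succ, ← hflat, ih]
  have hgc : g = fun _ => g 0 := by
    funext j
    rw [← ZMod.natCast_zmod_val j, hconst]
  calc shiftedPartition J h ≤ shiftedPartition J g₀ := hmax h hhT
    _ = shiftedPartition J g := hg.2.symm
    _ = shiftedPartition J 0 := by rw [hgc, shiftedPartition_const]

/-! ### The infrared bound in quadratic form -/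

/-- The unnormalized Gibbs sum of `f` for the coupling `J`. -/
def gibbsSum {N : ℕ} [NeZero N] (J : ZMod N → ℝ) (f : (ZMod N → ℤˣ) → ℝ) : ℝ :=
  ∑ σ, f σ * Real.exp (-gradEnergy J fun j => spin (σ j))

theorem gibbsSum_one {N : ℕ} [NeZero N] (J : ZMod N → ℝ) :
    gibbsSum J (fun _ => 1) = shiftedPartition J 0 := by
  simp [gibbsSum, shiftedPartition]

theorem gibbsSum_one_pos {N : ℕ} [NeZero N] (J : ZMod N → ℝ) : 0 < gibbsSum J (fun _ => 1) := by
  rw [gibbsSum_one]; exact shiftedPartition_pos J 0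

theorem gibbsSum_const_mul {N : ℕ} [NeZero N] (J : ZMod N → ℝ) (c : ℝ) (f : (ZMod N → ℤˣ) → ℝ) :
    gibbsSum J (fun σ => c * f σ) = c * gibbsSum J f := by
  simp only [gibbsSum, Finset.mul_sum, mul_assoc]

theorem gibbsSum_add {N : ℕ} [NeZero N] (J : ZMod N → ℝ) (f g : (ZMod N → ℤˣ) → ℝ) :
    gibbsSum J (fun σ => f σ + g σ) = gibbsSum J f + gibbsSum J g := by
  simp only [gibbsSum, add_mul, Finset.sum_add_distrib]

theorem gibbsSum_sub {N : ℕ} [NeZero N] (J : ZMod N → ℝ) (f g : (ZMod N → ℤˣ) → ℝ) :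
    gibbsSum J (fun σ => f σ - g σ) = gibbsSum J f - gibbsSum J g := by
  simp only [gibbsSum, sub_mul, Finset.sum_sub_distrib]

theorem gibbsSum_sum {N : ℕ} [NeZero N] (J : ZMod N → ℝ) {ι : Type*} (s : Finset ι)
    (f : ι → (ZMod N → ℤˣ) → ℝ) :
    gibbsSum J (fun σ => ∑ i ∈ s, f i σ) = ∑ i ∈ s, gibbsSum J (f i) := by
  simp only [gibbsSum, Finset.sum_mul]
  exact Finset.sum_comm

theorem gibbsSum_nonneg {N : ℕ} [NeZero N] (J : ZMod N → ℝ) {f : (ZMod N → ℤˣ) → ℝ}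
    (hf : ∀ σ, 0 ≤ f σ) : 0 ≤ gibbsSum J f :=
  Finset.sum_nonneg fun σ _ => mul_nonneg (hf σ) (Real.exp_pos _).le

theorem gibbsSum_translate {N : ℕ} [NeZero N] (J : ZMod N → ℝ) (f : (ZMod N → ℤˣ) → ℝ)
    (a : ZMod N) : gibbsSum J (fun σ => f fun j => σ (j + a)) = gibbsSum J f := by
  unfold gibbsSum
  refine Fintype.sum_equiv ((Equiv.subRight a).arrowCongr (Equiv.refl ℤˣ)) _ _ fun σ => ?_
  rw [← gradEnergy_translate J (fun j => spin (σ j)) a]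
  rfl

theorem gibbsSum_spin_mul_spin {N : ℕ} [NeZero N] (J : ZMod N → ℝ) (j k : ZMod N) :
    gibbsSum J (fun σ => spin (σ j) * spin (σ k)) =
      gibbsSum J (fun σ => spin (σ 0) * spin (σ (k - j))) := by
  rw [← gibbsSum_translate J (fun σ => spin (σ 0) * spin (σ (k - j))) j]
  simp

/-- The bilinear form of the quadratic form `2 * gradEnergy J`. -/
def gradForm {N : ℕ} [NeZero N] (J s h : ZMod N → ℝ) : ℝ :=
  (1 / 2) * ∑ j, ∑ k, J (j - k) * ((s j - s k) * (h j - h k))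

theorem gradEnergy_add_mul {N : ℕ} [NeZero N] (J s h : ZMod N → ℝ) (t : ℝ) :
    gradEnergy J (fun j => s j + t * h j) =
      gradEnergy J s + t * gradForm J s h + t ^ 2 * gradEnergy J h := by
  simp only [gradEnergy, gradForm, Finset.mul_sum, ← Finset.sum_add_distrib]
  exact Finset.sum_congr rfl fun _ _ => Finset.sum_congr rfl fun _ _ => by ring

theorem two_add_sq_le_exp_add_exp_neg (x : ℝ) : 2 + x ^ 2 ≤ Real.exp x + Real.exp (-x) := by
  have h : 2 + x ^ 2 ≤ 2 * Real.cosh x := by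
    rw [← Real.cosh_abs, ← sq_abs]
    have h1 := Real.cosh_sq' (|x| / 2)
    have h2 : Real.cosh |x| = 1 + 2 * Real.sinh (|x| / 2) ^ 2 := by
      have := Real.cosh_two_mul (|x| / 2)
      rw [mul_div_cancel₀ _ two_ne_zero] at this
      rw [this, h1]; ring
    have h3 : |x| / 2 ≤ Real.sinh (|x| / 2) := Real.self_le_sinh_iff.2 (by positivity)
    have h4 : (|x| / 2) ^ 2 ≤ Real.sinh (|x| / 2) ^ 2 := by gcongr
    rw [h2]
    linarith
  rw [Real.cosh_eq] at h
  linarith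

/-- The infrared bound in quadratic form. -/
theorem gibbsSum_gradForm_sq_le {m : ℕ} [NeZero m] {J : ZMod (2 * m) → ℝ}
    (hJ : ReflectionPositive J) (h : ZMod (2 * m) → ℝ) :
    gibbsSum J (fun σ => gradForm J (fun j => spin (σ j)) h ^ 2) ≤
      2 * gradEnergy J h * gibbsSum J (fun _ => 1) := by
  set B : (ZMod (2 * m) → ℤˣ) → ℝ := fun σ => gradForm J (fun j => spin (σ j)) h with hB
  set D := gradEnergy J h with hD
  have hW := gibbsSum_one_pos J
  have hQ : 0 ≤ gibbsSum J (fun σ => B σ ^ 2) := gibbsSum_nonneg J fun σ => sq_nonneg _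
  have hZ : ∀ t : ℝ, gibbsSum J (fun σ => Real.exp (t * B σ)) * Real.exp (-(t ^ 2 * D)) ≤
      gibbsSum J (fun _ => 1) := by
    intro t
    -- Gaussian domination for the field `-t h`; expanding the energy in `t` separates the linear
    -- term `t B` from the constant `t² D`.
    have h1 := shiftedPartition_le hJ (fun j => -t * h j)
    rw [gibbsSum_one]
    refine le_trans (le_of_eq ?_) h1
    rw [gibbsSum, shiftedPartition, Finset.sum_mul]
    refine Finset.sum_congr rfl fun σ _ => ?_
    rw [gradEnergy_add_mul, ← Real.exp_add, ← Real.exp_add]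
    congr 1
    simp only [hB, hD]
    ring
  have hsq : ∀ t : ℝ, 0 < t → gibbsSum J (fun σ => B σ ^ 2) * (1 - t ^ 2 * D) ≤
      2 * D * gibbsSum J (fun _ => 1) := by
    intro t ht
    have h1 := hZ t
    have h2 := hZ (-t)
    -- Adding the bounds for `t` and `-t` removes the odd orders. The second-order inequality is
    -- then divided by `t²`, and `t → 0` is taken at the end.
    have h3 : 2 * gibbsSum J (fun _ => 1) + t ^ 2 * gibbsSum J (fun σ => B σ ^ 2) ≤
        gibbsSum J (fun σ => Real.exp (t * B σ)) + gibbsSum J (fun σ => Real.exp (-t * B σ)) := by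
      rw [← gibbsSum_const_mul, ← gibbsSum_const_mul, ← gibbsSum_add, ← gibbsSum_add]
      refine Finset.sum_le_sum fun σ _ => mul_le_mul_of_nonneg_right ?_ (Real.exp_pos _).le
      have := two_add_sq_le_exp_add_exp_neg (t * B σ)
      change 2 * 1 + t ^ 2 * B σ ^ 2 ≤ Real.exp (t * B σ) + Real.exp (-t * B σ)
      rw [neg_mul]
      linarith [mul_pow t (B σ) 2]
    have h4 : 1 - t ^ 2 * D ≤ Real.exp (-(t ^ 2 * D)) := by
      linarith [Real.add_one_le_exp (-(t ^ 2 * D))]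
    rw [neg_sq] at h2
    have h5 : (1 - t ^ 2 * D) *
        (2 * gibbsSum J (fun _ => 1) + t ^ 2 * gibbsSum J (fun σ => B σ ^ 2)) ≤
        2 * gibbsSum J (fun _ => 1) := by
      calc _ ≤ Real.exp (-(t ^ 2 * D)) *
            (2 * gibbsSum J (fun _ => 1) + t ^ 2 * gibbsSum J (fun σ => B σ ^ 2)) :=
            mul_le_mul_of_nonneg_right h4 (by positivity)
        _ ≤ Real.exp (-(t ^ 2 * D)) * (gibbsSum J (fun σ => Real.exp (t * B σ)) +
            gibbsSum J (fun σ => Real.exp (-t * B σ))) := by gcongr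
        _ ≤ _ := by linarith
    have ht2 : 0 < t ^ 2 := by positivity
    refine le_of_mul_le_mul_left ?_ ht2
    linarith
  have hlim : Tendsto (fun t : ℝ => gibbsSum J (fun σ => B σ ^ 2) * (1 - t ^ 2 * D)) (𝓝[>] 0)
      (𝓝 (gibbsSum J (fun σ => B σ ^ 2))) := by
    have : Continuous fun t : ℝ => gibbsSum J (fun σ => B σ ^ 2) * (1 - t ^ 2 * D) := by fun_prop
    simpa using (this.tendsto 0).mono_left nhdsWithin_le_nhds
  exact le_of_tendsto hlim (eventually_nhdsWithin_of_forall fun t ht => hsq t ht)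

/-- Summation by parts: by evenness of `J` the terms with `s j` and those with `s k` contribute
equally. -/
theorem gradForm_of_eigenvector {N : ℕ} [NeZero N] {J : ZMod N → ℝ} (hJ : ∀ r, J (-r) = J r)
    {h : ZMod N → ℝ} {E : ℝ} (hE : ∀ j, ∑ k, J (j - k) * (h j - h k) = E * h j)
    (s : ZMod N → ℝ) : gradForm J s h = E * ∑ j, s j * h j := by
  have h1 : ∑ j, ∑ k, J (j - k) * (s j * (h j - h k)) = E * ∑ j, s j * h j := by
    rw [Finset.mul_sum]
    refine Finset.sum_congr rfl fun j _ => ?_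
    rw [mul_left_comm, ← hE, Finset.mul_sum]
    exact Finset.sum_congr rfl fun k _ => by ring
  have h2 : ∑ j, ∑ k, J (j - k) * (s k * (h j - h k)) = -(E * ∑ j, s j * h j) := by
    rw [← h1, Finset.sum_comm, ← Finset.sum_neg_distrib]
    refine Finset.sum_congr rfl fun j _ => ?_
    rw [← Finset.sum_neg_distrib]
    refine Finset.sum_congr rfl fun k _ => ?_
    rw [← hJ (k - j), neg_sub]
    ring
  have h3 : ∑ j, ∑ k, J (j - k) * ((s j - s k) * (h j - h k)) =
      ∑ j, ∑ k, J (j - k) * (s j * (h j - h k)) - ∑ j, ∑ k, J (j - k) * (s k * (h j - h k)) := by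
    simp only [← Finset.sum_sub_distrib]
    exact Finset.sum_congr rfl fun _ _ => Finset.sum_congr rfl fun _ _ => by ring
  rw [gradForm, h3, h1, h2]
  ring

theorem two_mul_gradEnergy {N : ℕ} [NeZero N] (J h : ZMod N → ℝ) :
    2 * gradEnergy J h = gradForm J h h := by
  simp only [gradEnergy, gradForm, Finset.mul_sum]
  exact Finset.sum_congr rfl fun _ _ => Finset.sum_congr rfl fun _ _ => by ring

/-- On an eigenvector the quadratic bound becomes `E² ⟨(∑ s h)²⟩ ≤ E ∑ h²`, and one factor `E`
cancels. -/
theorem gibbsSum_sq_le_of_eigenvector {m : ℕ} [NeZero m] {J : ZMod (2 * m) → ℝ}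
    (hJ : ReflectionPositive J) {h : ZMod (2 * m) → ℝ} {E : ℝ} (hE0 : 0 < E)
    (hE : ∀ j, ∑ k, J (j - k) * (h j - h k) = E * h j) :
    gibbsSum J (fun σ => (∑ j, spin (σ j) * h j) ^ 2) ≤
      (∑ j, h j ^ 2) / E * gibbsSum J (fun _ => 1) := by
  have h1 := gibbsSum_gradForm_sq_le hJ h
  simp only [two_mul_gradEnergy, gradForm_of_eigenvector hJ.even hE, mul_pow,
    gibbsSum_const_mul, ← sq] at h1
  rw [div_mul_eq_mul_div, le_div_iff₀ hE0]
  refine le_of_mul_le_mul_left ?_ hE0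
  linarith

/-! ### Fourier modes on the ring and the sum rule -/

/-- `cos (2π a / N)` as a function on the residues. -/
def ringCos {N : ℕ} [NeZero N] (a : ZMod N) : ℝ := (ZMod.stdAddChar a : ℂ).re

/-- `sin (2π a / N)` as a function on the residues. -/
def ringSin {N : ℕ} [NeZero N] (a : ZMod N) : ℝ := (ZMod.stdAddChar a : ℂ).im

theorem ringCos_sq_add_ringSin_sq {N : ℕ} [NeZero N] (a : ZMod N) :
    ringCos a ^ 2 + ringSin a ^ 2 = 1 := by
  have h : ‖(ZMod.stdAddChar a : ℂ)‖ = 1 := Circle.norm_coe _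
  have := Complex.sq_norm (ZMod.stdAddChar a : ℂ)
  rw [h, Complex.normSq_apply] at this
  simp only [ringCos, ringSin]
  linarith

theorem ringCos_le_one {N : ℕ} [NeZero N] (a : ZMod N) : ringCos a ≤ 1 := by
  nlinarith [ringCos_sq_add_ringSin_sq a, sq_nonneg (ringSin a), sq_nonneg (ringCos a - 1)]

theorem neg_one_le_ringCos {N : ℕ} [NeZero N] (a : ZMod N) : -1 ≤ ringCos a := by
  nlinarith [ringCos_sq_add_ringSin_sq a, sq_nonneg (ringSin a), sq_nonneg (ringCos a + 1)]

theorem ringCos_add {N : ℕ} [NeZero N] (a b : ZMod N) :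
    ringCos (a + b) = ringCos a * ringCos b - ringSin a * ringSin b := by
  simp [ringCos, ringSin, AddChar.map_add_eq_mul]

theorem ringSin_add {N : ℕ} [NeZero N] (a b : ZMod N) :
    ringSin (a + b) = ringSin a * ringCos b + ringCos a * ringSin b := by
  simp [ringCos, ringSin, AddChar.map_add_eq_mul]
  ring

theorem stdAddChar_neg {N : ℕ} [NeZero N] (a : ZMod N) :
    (ZMod.stdAddChar (-a) : ℂ) = (starRingEnd ℂ) (ZMod.stdAddChar a) := by
  rw [AddChar.map_neg_eq_inv, ZMod.stdAddChar_apply, ← Circle.coe_inv, Circle.coe_inv_eq_conj]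

theorem ringCos_neg {N : ℕ} [NeZero N] (a : ZMod N) : ringCos (-a) = ringCos a := by
  simp [ringCos, stdAddChar_neg]

theorem ringSin_neg {N : ℕ} [NeZero N] (a : ZMod N) : ringSin (-a) = -ringSin a := by
  simp [ringSin, stdAddChar_neg]

theorem ringCos_zero {N : ℕ} [NeZero N] : ringCos (0 : ZMod N) = 1 := by
  simp [ringCos]

theorem ringCos_sub {N : ℕ} [NeZero N] (a b : ZMod N) :
    ringCos (a - b) = ringCos a * ringCos b + ringSin a * ringSin b := by
  rw [sub_eq_add_neg, ringCos_add, ringCos_neg, ringSin_neg]; ring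

theorem ringSin_sub {N : ℕ} [NeZero N] (a b : ZMod N) :
    ringSin (a - b) = ringSin a * ringCos b - ringCos a * ringSin b := by
  rw [sub_eq_add_neg, ringSin_add, ringCos_neg, ringSin_neg]; ring

theorem sum_ringCos_mul {N : ℕ} [NeZero N] (a : ZMod N) :
    ∑ p : ZMod N, ringCos (p * a) = if a = 0 then (N : ℝ) else 0 := by
  have h := AddChar.sum_mulShift a (ZMod.isPrimitive_stdAddChar N)
  have h2 := congrArg Complex.re h
  rw [Complex.re_sum] at h2
  simp only [ringCos]
  rw [h2]
  split_ifs <;> simp [ZMod.card]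

/-- The dispersion relation of the coupling `J`. -/
def dispersion {N : ℕ} [NeZero N] (J : ZMod N → ℝ) (p : ZMod N) : ℝ :=
  ∑ r, J r * (1 - ringCos (p * r))

theorem sum_mul_ringSin {N : ℕ} [NeZero N] {J : ZMod N → ℝ} (hJ : ∀ r, J (-r) = J r)
    (p : ZMod N) : ∑ r, J r * ringSin (p * r) = 0 := by
  have h : ∑ r, J r * ringSin (p * r) = ∑ r, -(J r * ringSin (p * r)) := by
    refine Fintype.sum_equiv (Equiv.neg _) _ _ fun r => ?_
    simp [hJ, ringSin_neg]
  rw [Finset.sum_neg_distrib] at h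
  linarith

theorem sum_sub_eq {N : ℕ} [NeZero N] (J : ZMod N → ℝ) (f : ZMod N → ℝ) (j : ZMod N) :
    ∑ k, J (j - k) * (f j - f k) = ∑ r, J r * (f j - f (j - r)) := by
  refine Fintype.sum_equiv (Equiv.subLeft j) _ _ fun k => ?_
  simp

/-- The addition formula produces a sine term, which sums to zero against the even coupling. -/
theorem eigenvector_ringCos {N : ℕ} [NeZero N] {J : ZMod N → ℝ} (hJ : ∀ r, J (-r) = J r)
    (p j : ZMod N) : ∑ k, J (j - k) * (ringCos (p * j) - ringCos (p * k)) =
      dispersion J p * ringCos (p * j) := by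
  rw [sum_sub_eq J fun k => ringCos (p * k)]
  have h : ∀ r, J r * (ringCos (p * j) - ringCos (p * (j - r))) =
      J r * (1 - ringCos (p * r)) * ringCos (p * j)
        - J r * ringSin (p * r) * ringSin (p * j) := by
    intro r
    rw [mul_sub p, ringCos_sub]; ring
  simp only [h, Finset.sum_sub_distrib, ← Finset.sum_mul, sum_mul_ringSin hJ, dispersion]
  ring

theorem eigenvector_ringSin {N : ℕ} [NeZero N] {J : ZMod N → ℝ} (hJ : ∀ r, J (-r) = J r)
    (p j : ZMod N) : ∑ k, J (j - k) * (ringSin (p * j) - ringSin (p * k)) =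
      dispersion J p * ringSin (p * j) := by
  rw [sum_sub_eq J fun k => ringSin (p * k)]
  have h : ∀ r, J r * (ringSin (p * j) - ringSin (p * (j - r))) =
      J r * (1 - ringCos (p * r)) * ringSin (p * j)
        + J r * ringSin (p * r) * ringCos (p * j) := by
    intro r
    rw [mul_sub p, ringSin_sub]; ring
  simp only [h, Finset.sum_add_distrib, ← Finset.sum_mul, sum_mul_ringSin hJ, dispersion]
  ring

/-- The squared modulus of the Fourier transform of `s` at momentum `p`. -/
def structureFactor {N : ℕ} [NeZero N] (s : ZMod N → ℝ) (p : ZMod N) : ℝ :=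
  (∑ j, s j * ringCos (p * j)) ^ 2 + (∑ j, s j * ringSin (p * j)) ^ 2

theorem structureFactor_nonneg {N : ℕ} [NeZero N] (s : ZMod N → ℝ) (p : ZMod N) :
    0 ≤ structureFactor s p := by
  unfold structureFactor; positivity

theorem structureFactor_eq {N : ℕ} [NeZero N] (s : ZMod N → ℝ) (p : ZMod N) :
    structureFactor s p = ∑ j, ∑ k, s j * s k * ringCos (p * (j - k)) := by
  simp only [structureFactor, sq, Finset.sum_mul_sum, ← Finset.sum_add_distrib]
  refine Finset.sum_congr rfl fun j _ => Finset.sum_congr rfl fun k _ => ?_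
  rw [mul_sub, ringCos_sub]
  ring

/-- The infrared bound. -/
theorem gibbsSum_structureFactor_le {m : ℕ} [NeZero m] {J : ZMod (2 * m) → ℝ}
    (hJ : ReflectionPositive J) {p : ZMod (2 * m)} (hp : 0 < dispersion J p) :
    gibbsSum J (fun σ => structureFactor (fun j => spin (σ j)) p) ≤
      (2 * m) / dispersion J p * gibbsSum J (fun _ => 1) := by
  have h1 := gibbsSum_sq_le_of_eigenvector hJ hp (eigenvector_ringCos hJ.even p)
  have h2 := gibbsSum_sq_le_of_eigenvector hJ hp (eigenvector_ringSin hJ.even p)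
  have h3 : ∑ j : ZMod (2 * m), ringCos (p * j) ^ 2 + ∑ j : ZMod (2 * m), ringSin (p * j) ^ 2 =
      2 * m := by
    rw [← Finset.sum_add_distrib]
    simp [ringCos_sq_add_ringSin_sq, ZMod.card]
  unfold structureFactor
  rw [gibbsSum_add, ← h3, add_div, add_mul]
  exact add_le_add h1 h2

/-- Parseval's identity by orthogonality of characters. The weight is chosen to vanish at `p = 0`,
where no infrared bound is available. -/
theorem sum_structureFactor {N : ℕ} [NeZero N] (s : ZMod N → ℝ) (n : ZMod N) :
    ∑ p, (1 - ringCos (p * n)) * structureFactor s p =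
      N * ∑ j, (s j * s j - s j * s (j + n)) := by
  have h1 : ∀ p, (1 - ringCos (p * n)) * structureFactor s p =
      ∑ j, ∑ k, s j * s k * (ringCos (p * (j - k)) - (1 / 2) * ringCos (p * (j - k + n))
        - (1 / 2) * ringCos (p * (j - k - n))) := by
    intro p
    rw [structureFactor_eq, Finset.mul_sum]
    refine Finset.sum_congr rfl fun j _ => ?_
    rw [Finset.mul_sum]
    refine Finset.sum_congr rfl fun k _ => ?_
    rw [mul_add, mul_sub p (j - k) n, ringCos_add, ringCos_sub (p * (j - k))]
    ring
  simp only [h1]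
  rw [Finset.sum_comm]
  have h2 : ∀ j, ∑ p : ZMod N, ∑ k, s j * s k * (ringCos (p * (j - k))
      - (1 / 2) * ringCos (p * (j - k + n)) - (1 / 2) * ringCos (p * (j - k - n))) =
      N * (s j * s j - (1 / 2) * (s j * s (j + n)) - (1 / 2) * (s j * s (j - n))) := by
    intro j
    rw [Finset.sum_comm]
    have e1 : ∀ k, j - k = 0 ↔ k = j := fun k => by rw [sub_eq_zero, eq_comm]
    have e2 : ∀ k, j - k + n = 0 ↔ k = j + n := fun k => by
      rw [sub_add_eq_add_sub, sub_eq_zero, eq_comm]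
    have e3 : ∀ k, j - k - n = 0 ↔ k = j - n := fun k => by
      rw [sub_right_comm, sub_eq_zero, eq_comm]
    simp only [← Finset.mul_sum, Finset.sum_sub_distrib, sum_ringCos_mul, e1, e2, e3]
    simp only [mul_sub, Finset.sum_sub_distrib, mul_ite, mul_zero, Finset.sum_ite_eq',
      Finset.mem_univ, if_true]
    ring
  simp only [h2, ← Finset.mul_sum, Finset.sum_sub_distrib]
  have h3 : ∑ j, s j * s (j - n) = ∑ j, s j * s (j + n) := by
    refine Fintype.sum_equiv (Equiv.subRight n) _ _ fun j => ?_
    simp [mul_comm]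
  rw [h3]
  ring

/-- A lower bound on the two-point function that is uniform in the distance. -/
theorem le_gibbsSum_spin_mul_spin {m : ℕ} [NeZero m] {J : ZMod (2 * m) → ℝ}
    (hJ : ReflectionPositive J) (hpos : ∀ p, p ≠ 0 → 0 < dispersion J p) (j k : ZMod (2 * m)) :
    (1 - (1 / m) * ∑ p ∈ Finset.univ.erase 0, 1 / dispersion J p) * gibbsSum J (fun _ => 1) ≤
      gibbsSum J (fun σ => spin (σ j) * spin (σ k)) := by
  have hm : (0 : ℝ) < m := Nat.cast_pos.2 (Nat.pos_of_ne_zero (NeZero.ne m))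
  rw [gibbsSum_spin_mul_spin]
  set n := k - j
  have h1 : ∑ p, (1 - ringCos (p * n)) *
      gibbsSum J (fun σ => structureFactor (fun j => spin (σ j)) p) =
      (2 * m) * ((2 * m) * (gibbsSum J (fun _ => 1)
        - gibbsSum J (fun σ => spin (σ 0) * spin (σ n)))) := by
    simp only [← gibbsSum_const_mul]
    rw [← gibbsSum_sum]
    simp only [sum_structureFactor, spin_mul_self]
    rw [gibbsSum_const_mul, gibbsSum_sum]
    simp only [gibbsSum_sub]
    have : ∀ i, gibbsSum J (fun σ => spin (σ i) * spin (σ (i + n))) =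
        gibbsSum J (fun σ => spin (σ 0) * spin (σ n)) := fun i => by
      rw [gibbsSum_spin_mul_spin]; simp
    simp only [this, Finset.sum_const, Finset.card_univ, ZMod.card, nsmul_eq_mul, Nat.cast_mul,
      Nat.cast_ofNat, mul_sub]
  have h2 : ∑ p, (1 - ringCos (p * n)) *
      gibbsSum J (fun σ => structureFactor (fun j => spin (σ j)) p) ≤
      ∑ p ∈ Finset.univ.erase 0, 2 * ((2 * m) / dispersion J p * gibbsSum J (fun _ => 1)) := by
    -- The zero mode drops out; every other weight `1 - cos` is at most `2`.
    rw [← Finset.add_sum_erase _ _ (Finset.mem_univ (0 : ZMod (2 * m)))]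
    rw [zero_mul, ringCos_zero, sub_self, zero_mul, zero_add]
    refine Finset.sum_le_sum fun p hp => ?_
    have h3 := gibbsSum_structureFactor_le hJ (hpos p (Finset.ne_of_mem_erase hp))
    have h4 := neg_one_le_ringCos (p * n)
    refine mul_le_mul (by linarith) h3 (gibbsSum_nonneg J fun σ => structureFactor_nonneg _ _)
      zero_le_two
  have h5 : ∑ p ∈ Finset.univ.erase 0, 2 * ((2 * m) / dispersion J p * gibbsSum J (fun _ => 1)) =
      (2 * m) * ((2 * m) * ((1 / m) * (∑ p ∈ Finset.univ.erase 0, 1 / dispersion J p) *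
        gibbsSum J (fun _ => 1))) := by
    simp only [Finset.mul_sum, Finset.sum_mul]
    refine Finset.sum_congr rfl fun p _ => ?_
    field_simp
  rw [h1, h5] at h2
  have h6 := le_of_mul_le_mul_left (le_of_mul_le_mul_left h2 (by positivity)) (by positivity)
  linarith

/-! ### Reflection positivity of the periodized power law -/

/-- By the Gamma integral, `Γ(α) / (a_i + a_j)^α = ∫ t^(α-1) e^(-a_i t) e^(-a_j t) dt`, so the form
is an integral of squares. -/
theorem sum_mul_add_rpow_nonneg {L : Type*} [Fintype L] {α : ℝ} (hα : 0 < α) (a : L → ℝ)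
    (ha : ∀ i, 0 < a i) (c : L → ℝ) :
    0 ≤ ∑ i, ∑ j, c i * c j * (1 / (a i + a j) ^ α) := by
  have hG := Real.Gamma_pos_of_pos hα
  have hI : ∀ i j, ∫ t : ℝ in Set.Ioi 0, t ^ (α - 1) * Real.exp (-((a i + a j) * t)) =
      1 / (a i + a j) ^ α * Real.Gamma α := by
    intro i j
    have hp : 0 < a i + a j := add_pos (ha i) (ha j)
    rw [Real.integral_rpow_mul_exp_neg_mul_Ioi hα hp, Real.div_rpow zero_le_one hp.le,
      Real.one_rpow]
  have hint : ∀ i j, IntegrableOn (fun t : ℝ => t ^ (α - 1) * Real.exp (-((a i + a j) * t)))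
      (Set.Ioi 0) := by
    intro i j
    -- The integral of a non-integrable function is `0` by convention, whereas the Gamma formula
    -- gives a positive value.
    by_contra hcon
    have h1 := hI i j
    rw [integral_undef hcon] at h1
    have hp : 0 < a i + a j := add_pos (ha i) (ha j)
    have : 0 < 1 / (a i + a j) ^ α * Real.Gamma α := by positivity
    linarith
  have h2 : (∑ i, ∑ j, c i * c j * (1 / (a i + a j) ^ α)) * Real.Gamma α =
      ∫ t : ℝ in Set.Ioi 0, t ^ (α - 1) * (∑ i, c i * Real.exp (-(a i * t))) ^ 2 := by
    have h3 : ∀ t : ℝ, t ^ (α - 1) * (∑ i, c i * Real.exp (-(a i * t))) ^ 2 =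
        ∑ i, ∑ j, c i * c j * (t ^ (α - 1) * Real.exp (-((a i + a j) * t))) := by
      intro t
      rw [sq, Finset.sum_mul_sum, Finset.mul_sum]
      refine Finset.sum_congr rfl fun i _ => ?_
      rw [Finset.mul_sum]
      refine Finset.sum_congr rfl fun j _ => ?_
      rw [add_mul, neg_add, Real.exp_add]
      ring
    simp only [h3]
    rw [integral_finsetSum _ fun i _ => integrable_finsetSum _ fun j _ => (hint i j).const_mul _,
      Finset.sum_mul]
    refine Finset.sum_congr rfl fun i _ => ?_
    rw [integral_finsetSum _ fun j _ => (hint i j).const_mul _, Finset.sum_mul]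
    refine Finset.sum_congr rfl fun j _ => ?_
    rw [integral_const_mul, hI]
    ring
  have h4 : 0 ≤ (∑ i, ∑ j, c i * c j * (1 / (a i + a j) ^ α)) * Real.Gamma α := by
    rw [h2]
    exact setIntegral_nonneg measurableSet_Ioi fun t ht =>
      mul_nonneg (Real.rpow_nonneg (le_of_lt ht) _) (sq_nonneg _)
  exact nonneg_of_mul_nonneg_left h4 hG

theorem summable_periodized {α : ℝ} (hα : 1 < α) {m : ℕ} (hm : 0 < m) (v : ℝ) :
    Summable fun n : ℤ => 1 / |v + 2 * (m : ℝ) * (n : ℝ)| ^ α := by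
  have hm' : (0 : ℝ) < 2 * m := by positivity
  have h := ((Real.summable_one_div_int_add_rpow (v / (2 * m)) α).2 hα).mul_left (1 / (2 * m : ℝ) ^ α)
  refine h.congr fun n => ?_
  have e : v + 2 * (m : ℝ) * n = 2 * m * (n + v / (2 * m)) := by field_simp; ring
  rw [e, abs_mul, abs_of_pos hm', Real.mul_rpow hm'.le (abs_nonneg _), one_div_mul_one_div]

/-- Reindexing by `n ↦ -1 - n` matches the representative `2m - r` of `-r`; this is its `val` only
for `r ≠ 0`. -/
theorem periodicJ_neg (α : ℝ) {m : ℕ} [NeZero m] {r : ZMod (2 * m)} (hr : r ≠ 0) :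
    periodicJ α m (-r) = periodicJ α m r := by
  unfold periodicJ
  rw [← (Equiv.subLeft (-1 : ℤ)).tsum_eq]
  refine tsum_congr fun n => ?_
  have hv := ZMod.val_lt r
  have : NeZero r := ⟨hr⟩
  rw [ZMod.val_neg_of_ne_zero, Nat.cast_sub hv.le]
  congr 2
  rw [← abs_neg]
  congr 1
  simp
  ring

theorem periodicJ_nonneg (α : ℝ) (m : ℕ) (r : ZMod (2 * m)) : 0 ≤ periodicJ α m r :=
  tsum_nonneg fun n => by positivity

theorem one_div_val_rpow_le_periodicJ {α : ℝ} (hα : 1 < α) {m : ℕ} [NeZero m]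
    (r : ZMod (2 * m)) : 1 / (r.val : ℝ) ^ α ≤ periodicJ α m r := by
  have h := (summable_periodized hα (Nat.pos_of_ne_zero (NeZero.ne m)) r.val).le_tsum 0
    fun n _ => by positivity
  have hr : (0 : ℝ) ≤ r.val := Nat.cast_nonneg _
  simp only [Int.cast_zero, mul_zero, add_zero, abs_of_nonneg hr] at h
  exact h

/-- The total coupling between two sites at displacement `r` on the ring. -/
def ringCoupling (α γ ε : ℝ) (m : ℕ) (r : ZMod (2 * m)) : ℝ :=
  (γ - ε) * ((if r = 1 then 1 else 0) + if r = -1 then 1 else 0)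
    + ε * if r = 0 then 0 else periodicJ α m r

theorem ringCoupling_neg (α γ ε : ℝ) {m : ℕ} [NeZero m] (r : ZMod (2 * m)) :
    ringCoupling α γ ε m (-r) = ringCoupling α γ ε m r := by
  unfold ringCoupling
  have h1 : -r = 1 ↔ r = -1 := neg_eq_iff_eq_neg
  simp only [h1, neg_inj, neg_eq_zero]
  congr 1
  · rw [add_comm]
  · split_ifs with h
    · rfl
    · rw [periodicJ_neg α h]

/-- The only nearest-neighbour bonds across the cut join site `0` and site `m - 1` to their own
mirror images. -/
theorem crossCoupling_ringCoupling (α γ ε : ℝ) {m : ℕ} [NeZero m] (i j : Fin m) :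
    crossCoupling (ringCoupling α γ ε m) i j =
      (γ - ε) * ((if (i : ℕ) = 0 then 1 else 0) * (if (j : ℕ) = 0 then 1 else 0)
        + (if (i : ℕ) + 1 = m then 1 else 0) * (if (j : ℕ) + 1 = m then 1 else 0))
      + ε * ∑' n : ℤ, 1 / |(((i : ℕ) + (j : ℕ) + 1 : ℕ) : ℝ) + 2 * (m : ℝ) * (n : ℝ)| ^ α := by
  have hi := i.2
  have hj := j.2
  have e : ((i : ℕ) : ZMod (2 * m)) + ((j : ℕ) : ZMod (2 * m)) + 1 =
      (((i : ℕ) + (j : ℕ) + 1 : ℕ) : ZMod (2 * m)) := by push_cast; ring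
  have h1 : (((i : ℕ) + (j : ℕ) + 1 : ℕ) : ZMod (2 * m)) = 1 ↔ (i : ℕ) = 0 ∧ (j : ℕ) = 0 := by
    rw [← Nat.cast_one (R := ZMod (2 * m)), ZMod.natCast_eq_natCast_iff', Nat.mod_eq_of_lt (by omega),
      Nat.mod_eq_of_lt (by omega)]
    omega
  have h2 : (((i : ℕ) + (j : ℕ) + 1 : ℕ) : ZMod (2 * m)) = -1 ↔
      (i : ℕ) + 1 = m ∧ (j : ℕ) + 1 = m := by
    have : (-1 : ZMod (2 * m)) = ((2 * m - 1 : ℕ) : ZMod (2 * m)) := by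
      rw [Nat.cast_sub (by omega)]; simp
    rw [this, ZMod.natCast_eq_natCast_iff', Nat.mod_eq_of_lt (by omega),
      Nat.mod_eq_of_lt (by omega)]
    omega
  have h3 : (((i : ℕ) + (j : ℕ) + 1 : ℕ) : ZMod (2 * m)) ≠ 0 := by
    rw [← Nat.cast_zero (R := ZMod (2 * m)), Ne, ZMod.natCast_eq_natCast_iff', Nat.mod_eq_of_lt (by omega),
      Nat.mod_eq_of_lt (by omega)]
    omega
  rw [crossCoupling, Matrix.of_apply, e, ringCoupling]
  simp only [h1, h2, h3, if_false, periodicJ]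
  rw [ZMod.val_natCast, Nat.mod_eq_of_lt (by omega)]
  congr 2
  congr 1 <;> simp only [ite_and, ite_mul, one_mul, zero_mul]

theorem reflectionPositive_ringCoupling {α γ ε : ℝ} (hα : 1 < α) (hε : 0 ≤ ε) (hγ : ε ≤ γ)
    (m : ℕ) [NeZero m] : ReflectionPositive (ringCoupling α γ ε m) := by
  have hm : 0 < m := Nat.pos_of_ne_zero (NeZero.ne m)
  refine ⟨ringCoupling_neg α γ ε, Matrix.PosSemidef.of_dotProduct_mulVec_nonneg ?_ fun c => ?_⟩
  · ext i j
    simp only [Matrix.conjTranspose_apply, star_trivial, crossCoupling, Matrix.of_apply]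
    congr 1
    ring
  have hsum : ∀ i j : Fin m, Summable fun n : ℤ => c i * c j *
      (1 / |(((i : ℕ) + (j : ℕ) + 1 : ℕ) : ℝ) + 2 * (m : ℝ) * (n : ℝ)| ^ α) :=
    fun i j => (summable_periodized hα hm _).mul_left _
  have hP : 0 ≤ ∑ i : Fin m, ∑ j : Fin m, c i * c j *
      ∑' n : ℤ, 1 / |(((i : ℕ) + (j : ℕ) + 1 : ℕ) : ℝ) + 2 * (m : ℝ) * (n : ℝ)| ^ α := by
    simp only [← tsum_mul_left]
    have h1 : ∀ i : Fin m, ∑ j : Fin m, ∑' n : ℤ, c i * c j *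
        (1 / |(((i : ℕ) + (j : ℕ) + 1 : ℕ) : ℝ) + 2 * (m : ℝ) * (n : ℝ)| ^ α) =
        ∑' n : ℤ, ∑ j : Fin m, c i * c j *
        (1 / |(((i : ℕ) + (j : ℕ) + 1 : ℕ) : ℝ) + 2 * (m : ℝ) * (n : ℝ)| ^ α) := fun i =>
      (Summable.tsum_finsetSum fun j _ => hsum i j).symm
    simp only [h1]
    rw [← Summable.tsum_finsetSum fun i _ => summable_sum fun j _ => hsum i j]
    refine tsum_nonneg fun n => ?_
    have hlt : ∀ i : Fin m, (i : ℝ) + 1 ≤ m := fun i => by exact_mod_cast i.2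
    have hm' : (0 : ℝ) < m := by exact_mod_cast hm
    -- For each image `n` the distance `|i + j + 1 + 2mn|` splits as `a_i + a_j` with `a_i = ±(i +
    -- 1/2 + mn)`. The sign is that of `n`, with `+` at `n = 0`; for `n ≤ -1` positivity uses `i + 1
    -- ≤ m`.
    rcases le_or_gt 0 n with hn | hn
    · have hn' : (0 : ℝ) ≤ n := by exact_mod_cast hn
      have ha : ∀ i : Fin m, (0 : ℝ) < i + 1 / 2 + m * n := fun i => by positivity
      refine (sum_mul_add_rpow_nonneg (zero_lt_one.trans hα) _ ha c).trans_eq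
        (Finset.sum_congr rfl fun i _ => Finset.sum_congr rfl fun j _ => ?_)
      have e : |(((i : ℕ) + (j : ℕ) + 1 : ℕ) : ℝ) + 2 * (m : ℝ) * (n : ℝ)| =
          ((i : ℝ) + 1 / 2 + m * n) + (j + 1 / 2 + m * n) := by
        rw [abs_of_nonneg (by positivity)]
        push_cast
        ring
      rw [e]
    · have hn' : (n : ℝ) ≤ -1 := by exact_mod_cast Int.le_sub_one_of_lt hn
      have ha : ∀ i : Fin m, (0 : ℝ) < -(i + 1 / 2 + m * n) := fun i => by
        have := hlt i
        nlinarith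
      refine (sum_mul_add_rpow_nonneg (zero_lt_one.trans hα) _ ha c).trans_eq
        (Finset.sum_congr rfl fun i _ => Finset.sum_congr rfl fun j _ => ?_)
      have e : |(((i : ℕ) + (j : ℕ) + 1 : ℕ) : ℝ) + 2 * (m : ℝ) * (n : ℝ)| =
          -((i : ℝ) + 1 / 2 + m * n) + -(j + 1 / 2 + m * n) := by
        have h2 := ha i
        have h3 := ha j
        rw [abs_of_neg (by push_cast; linarith)]
        push_cast
        ring
      rw [e]
  have hsq : ∀ u : Fin m → ℝ, ∑ i, ∑ j, c i * c j * (u i * u j) = (∑ i, c i * u i) ^ 2 := by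
    intro u
    rw [sq, Finset.sum_mul_sum]
    exact Finset.sum_congr rfl fun _ _ => Finset.sum_congr rfl fun _ _ => by ring
  have hform : star c ⬝ᵥ (crossCoupling (ringCoupling α γ ε m)).mulVec c =
      (γ - ε) * ((∑ i, c i * (if (i : ℕ) = 0 then 1 else 0)) ^ 2
        + (∑ i, c i * (if (i : ℕ) + 1 = m then 1 else 0)) ^ 2)
      + ε * ∑ i : Fin m, ∑ j : Fin m, c i * c j *
      ∑' n : ℤ, 1 / |(((i : ℕ) + (j : ℕ) + 1 : ℕ) : ℝ) + 2 * (m : ℝ) * (n : ℝ)| ^ α := by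
    rw [← hsq, ← hsq]
    simp only [dotProduct, Matrix.mulVec, crossCoupling_ringCoupling, Finset.mul_sum,
      ← Finset.sum_add_distrib, Pi.star_apply, star_trivial]
    exact Finset.sum_congr rfl fun _ _ => Finset.sum_congr rfl fun _ _ => by ring
  rw [hform]
  have := sub_nonneg.2 hγ
  positivity

/-! ### The Gibbs expectation in terms of the gradient energy -/

/-- Since `σ² = 1`, one has `(σ_j - σ_k)² = 2 - 2 σ_j σ_k`. The additive constant cancels in Gibbs
expectations. -/
theorem hamiltonian_eq_gradEnergy (α γ ε : ℝ) (m : ℕ) [NeZero m] (σ : ZMod (2 * m) → ℤˣ) :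
    hamiltonian α γ ε m σ = gradEnergy (ringCoupling α γ ε m) (fun j => spin (σ j))
      - (1 / 2) * ∑ j, ∑ k, ringCoupling α γ ε m (j - k) := by
  set s : ZMod (2 * m) → ℝ := fun j => spin (σ j) with hs
  have h1 : gradEnergy (ringCoupling α γ ε m) s =
      (1 / 2) * ∑ j, ∑ k, ringCoupling α γ ε m (j - k)
        - (1 / 2) * ∑ j, ∑ k, ringCoupling α γ ε m (j - k) * (s j * s k) := by
    simp only [gradEnergy, Finset.mul_sum, ← Finset.sum_sub_distrib]
    refine Finset.sum_congr rfl fun j _ => Finset.sum_congr rfl fun k _ => ?_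
    have e : (s j - s k) ^ 2 = 2 - 2 * (s j * s k) := by
      rw [sub_sq, hs]
      simp only [spin_sq]
      ring
    rw [e]
    ring
  have h2 : ∀ j, ∑ k, ringCoupling α γ ε m (j - k) * (s j * s k) =
      (γ - ε) * (s j * s (j - 1) + s j * s (j + 1))
        + ε * ∑ k ∈ Finset.univ.erase j, periodicJ α m (j - k) * (s j * s k) := by
    intro j
    have e1 : ∀ k, j - k = 1 ↔ k = j - 1 := fun k => by
      rw [sub_eq_iff_eq_add, eq_sub_iff_add_eq, add_comm, eq_comm]
    have e2 : ∀ k, j - k = -1 ↔ k = j + 1 := fun k => by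
      rw [sub_eq_iff_eq_add, neg_add_eq_sub, eq_sub_iff_add_eq, eq_comm]
    have e3 : ∑ k, (if j - k = 0 then 0 else periodicJ α m (j - k)) * (s j * s k) =
        ∑ k ∈ Finset.univ.erase j, periodicJ α m (j - k) * (s j * s k) := by
      rw [← Finset.add_sum_erase _ _ (Finset.mem_univ j), sub_self, if_pos rfl, zero_mul, zero_add]
      refine Finset.sum_congr rfl fun k hk => ?_
      rw [if_neg (sub_ne_zero.2 (Finset.ne_of_mem_erase hk).symm)]
    rw [← e3, Finset.mul_sum]
    have e4 : (γ - ε) * (s j * s (j - 1) + s j * s (j + 1)) =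
        ∑ k, (γ - ε) * ((if j - k = 1 then 1 else 0) + if j - k = -1 then 1 else 0) *
          (s j * s k) := by
      simp only [e1, e2, mul_assoc, ← Finset.mul_sum, add_mul, Finset.sum_add_distrib, ite_mul,
        one_mul, zero_mul, Finset.sum_ite_eq', Finset.mem_univ, if_true]
    rw [e4, ← Finset.sum_add_distrib]
    refine Finset.sum_congr rfl fun k _ => ?_
    rw [ringCoupling]
    ring
  have h3 : ∑ j, s j * s (j - 1) = ∑ j, s j * s (j + 1) := by
    refine Fintype.sum_equiv (Equiv.subRight 1) _ _ fun j => ?_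
    simp [mul_comm]
  rw [h1]
  simp only [h2, Finset.sum_add_distrib, ← Finset.mul_sum, h3]
  rw [hamiltonian]
  ring

theorem gibbsExp_eq_gibbsSum_div (α γ ε : ℝ) (m : ℕ) [NeZero m] (f : (ZMod (2 * m) → ℤˣ) → ℝ) :
    gibbsExp α γ ε m f =
      gibbsSum (ringCoupling α γ ε m) f / gibbsSum (ringCoupling α γ ε m) fun _ => 1 := by
  have h : ∀ σ, Real.exp (-hamiltonian α γ ε m σ) =
      Real.exp (-gradEnergy (ringCoupling α γ ε m) fun j => spin (σ j)) *
        Real.exp ((1 / 2) * ∑ j, ∑ k, ringCoupling α γ ε m (j - k)) := by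
    intro σ
    rw [hamiltonian_eq_gradEnergy, ← Real.exp_add]
    congr 1
    ring
  simp only [gibbsExp, gibbsSum, h, ← mul_assoc, ← Finset.sum_mul, one_mul]
  rw [mul_div_mul_right _ _ (Real.exp_ne_zero _)]

/-! ### Lower bounds on the dispersion relation and summation over momenta -/

/-- A discrete comparison with `∫ x^(-s)`; the induction step is Bernoulli's inequality for an
exponent in `[0, 1]`. -/
theorem sum_rpow_neg_le {s : ℝ} (hs0 : 0 ≤ s) (hs1 : s < 1) (m : ℕ) :
    ∑ k ∈ Finset.Icc 1 m, (k : ℝ) ^ (-s) ≤ (m : ℝ) ^ (1 - s) / (1 - s) := by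
  have h1 : 0 < 1 - s := by linarith
  induction m with
  | zero => simp [Real.zero_rpow h1.ne']
  | succ m ih =>
    rw [Finset.sum_Icc_succ_top (by omega)]
    have hp : (0 : ℝ) < (m + 1 : ℕ) := by positivity
    set y : ℝ := ((m + 1 : ℕ) : ℝ) with hy
    have hy1 : 1 ≤ y := by rw [hy]; push_cast; linarith [(Nat.cast_nonneg m : (0 : ℝ) ≤ m)]
    have hm : (m : ℝ) = y * (1 + -(1 / y)) := by
      have : y = m + 1 := by rw [hy]; push_cast; rfl
      field_simp
      linarith
    have hb : -1 ≤ -(1 / y) := by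
      rw [neg_le_neg_iff, div_le_one hp]; exact hy1
    have h2 : (m : ℝ) ^ (1 - s) ≤ y ^ (1 - s) - (1 - s) * y ^ (-s) := by
      rw [hm, Real.mul_rpow hp.le (by linarith)]
      have h3 := rpow_one_add_le_one_add_mul_self hb h1.le (by linarith : 1 - s ≤ 1)
      have h4 : y ^ (1 - s) = y * y ^ (-s) := by
        rw [sub_eq_add_neg, Real.rpow_add hp, Real.rpow_one]
      calc y ^ (1 - s) * (1 + -(1 / y)) ^ (1 - s)
          ≤ y ^ (1 - s) * (1 + (1 - s) * -(1 / y)) :=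
            mul_le_mul_of_nonneg_left h3 (Real.rpow_nonneg hp.le _)
        _ = _ := by rw [h4]; field_simp; ring
    calc _ ≤ (m : ℝ) ^ (1 - s) / (1 - s) + y ^ (-s) := by linarith
      _ ≤ _ := by
        rw [le_div_iff₀ h1, add_mul, div_mul_cancel₀ _ h1.ne']
        linarith

/-- Only the residues `k` and `-k` can have absolute value `k`. -/
theorem sum_natAbs_valMinAbs_le {m : ℕ} [NeZero m] {f : ℕ → ℝ} (hf : ∀ k, 0 ≤ f k) :
    ∑ p ∈ (Finset.univ : Finset (ZMod (2 * m))).erase 0, f p.valMinAbs.natAbs ≤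
      2 * ∑ k ∈ Finset.Icc 1 m, f k := by
  classical
  have hmap : ∀ p ∈ (Finset.univ : Finset (ZMod (2 * m))).erase 0,
      p.valMinAbs.natAbs ∈ Finset.Icc 1 m := by
    intro p hp
    have h1 := ZMod.natAbs_valMinAbs_le p
    have h2 : p.valMinAbs ≠ 0 := by
      rw [Ne, ZMod.valMinAbs_eq_zero]; exact Finset.ne_of_mem_erase hp
    rw [Finset.mem_Icc]
    omega
  rw [← Finset.sum_fiberwise_of_maps_to hmap, Finset.mul_sum]
  refine Finset.sum_le_sum fun k _ => ?_
  have hcard : (((Finset.univ : Finset (ZMod (2 * m))).erase 0).filter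
      fun p => p.valMinAbs.natAbs = k).card ≤ 2 := by
    refine (Finset.card_le_card (t := {(k : ZMod (2 * m)), -(k : ZMod (2 * m))}) ?_).trans
      Finset.card_le_two
    intro p hp
    have hk := (Finset.mem_filter.1 hp).2
    rw [Finset.mem_insert, Finset.mem_singleton]
    rcases Int.natAbs_eq_iff.1 hk with h | h
    · left
      rw [← ZMod.coe_valMinAbs p, h, Int.cast_natCast]
    · right
      rw [← ZMod.coe_valMinAbs p, h, Int.cast_neg, Int.cast_natCast]
  rw [Finset.sum_congr rfl fun p hp => by rw [(Finset.mem_filter.1 hp).2], Finset.sum_const,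
    nsmul_eq_mul]
  exact mul_le_mul_of_nonneg_right (by exact_mod_cast hcard) (hf k)

theorem ringCos_mul_natCast {m : ℕ} [NeZero m] (p : ZMod (2 * m)) (r : ℕ) :
    ringCos (p * (r : ZMod (2 * m))) =
      Real.cos (Real.pi * ((p.valMinAbs.natAbs : ℝ) / m) * r) := by
  have e : p * (r : ZMod (2 * m)) = ((p.valMinAbs * r : ℤ) : ZMod (2 * m)) := by
    push_cast
    rfl
  have hm : (m : ℝ) ≠ 0 := Nat.cast_ne_zero.2 (NeZero.ne m)
  rw [e, ringCos, ZMod.stdAddChar_coe]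
  have e2 : (2 * Real.pi * Complex.I * ((p.valMinAbs * r : ℤ) : ℂ) / ((2 * m : ℕ) : ℂ)) =
      ((Real.pi * ((p.valMinAbs : ℝ) / m) * r : ℝ) : ℂ) * Complex.I := by
    have hm' : (m : ℂ) ≠ 0 := Nat.cast_ne_zero.2 (NeZero.ne m)
    push_cast
    field_simp
  rw [e2, Complex.exp_ofReal_mul_I_re, Nat.cast_natAbs, Int.cast_abs]
  rw [← Real.cos_abs (Real.pi * (|(p.valMinAbs : ℝ)| / m) * r), ← Real.cos_abs]
  simp only [abs_mul, abs_div, abs_abs]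

theorem one_sub_cos_ge {x : ℝ} (h0 : 0 ≤ x) (h1 : x ≤ Real.pi) :
    2 / Real.pi ^ 2 * x ^ 2 ≤ 1 - Real.cos x := by
  have := Real.cos_le_one_sub_mul_cos_sq (x := x) (by rwa [abs_of_nonneg h0])
  linarith

theorem dispersion_ringCoupling (α γ ε : ℝ) {m : ℕ} [NeZero m] (p : ZMod (2 * m)) :
    dispersion (ringCoupling α γ ε m) p = 2 * (γ - ε) * (1 - ringCos p)
      + ε * ∑ r ∈ Finset.univ.erase 0, periodicJ α m r * (1 - ringCos (p * r)) := by
  have h1 : ∑ r ∈ Finset.univ.erase 0, periodicJ α m r * (1 - ringCos (p * r)) =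
      ∑ r : ZMod (2 * m), (if r = 0 then 0 else periodicJ α m r) * (1 - ringCos (p * r)) := by
    rw [← Finset.add_sum_erase _ _ (Finset.mem_univ (0 : ZMod (2 * m))), if_pos rfl, zero_mul,
      zero_add]
    exact Finset.sum_congr rfl fun r hr => by rw [if_neg (Finset.ne_of_mem_erase hr)]
  have h2 : 2 * (γ - ε) * (1 - ringCos p) = ∑ r : ZMod (2 * m),
      (γ - ε) * ((if r = 1 then 1 else 0) + if r = -1 then 1 else 0) * (1 - ringCos (p * r)) := by
    simp only [mul_assoc, ← Finset.mul_sum, add_mul, Finset.sum_add_distrib, ite_mul, one_mul,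
      zero_mul, Finset.sum_ite_eq', Finset.mem_univ, if_true, mul_one, mul_neg, ringCos_neg]
    ring
  rw [h1, h2, Finset.mul_sum, ← Finset.sum_add_distrib, dispersion]
  refine Finset.sum_congr rfl fun r _ => ?_
  rw [ringCoupling]
  ring

/-- The long-range part of the dispersion relation is at least of order `|p| ^ (α - 1)`. -/
theorem le_sum_periodicJ_mul {α : ℝ} (hα₁ : 1 < α) (hα₂ : α < 2) {m : ℕ} [NeZero m]
    {p : ZMod (2 * m)} (hp : p ≠ 0) :
    (1 / 4) * ((p.valMinAbs.natAbs : ℝ) / m) ^ (α - 1) ≤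
      ∑ r ∈ Finset.univ.erase 0, periodicJ α m r * (1 - ringCos (p * r)) := by
  classical
  have hm : 0 < m := Nat.pos_of_ne_zero (NeZero.ne m)
  set k := p.valMinAbs.natAbs with hk
  have hk0 : 0 < k := Int.natAbs_pos.2 (by rwa [Ne, ZMod.valMinAbs_eq_zero])
  have hkm : k ≤ m := by
    have := ZMod.natAbs_valMinAbs_le p
    omega
  -- Only displacements `1 ≤ r ≤ R ≈ 1/x` are kept. There `π x r ≤ π`, so `1 - cos (π x r) ≥ 2 x²
  -- r²`, and the sum is at least `x² R^(3-α)`. Finally `R ≥ 1/(2x)` and `3 - α ≤ 2` give the factor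
  -- `1/4`.
  set R := m / k with hR
  have hR1 : 1 ≤ R := Nat.div_pos hkm hk0
  have hRm : R * k ≤ m := Nat.div_mul_le_self m k
  have hRle : R ≤ m := Nat.div_le_self m k
  have hR2 : m ≤ 2 * R * k := by
    have h1 : m < (R + 1) * k := Nat.lt_mul_of_div_lt (Nat.lt_succ_self _) hk0
    nlinarith
  have hm' : (0 : ℝ) < m := by exact_mod_cast hm
  have hk' : (0 : ℝ) < k := by exact_mod_cast hk0
  have hR' : (0 : ℝ) < R := by exact_mod_cast hR1
  set x : ℝ := (k : ℝ) / m with hx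
  have hx0 : 0 < x := by positivity
  have hterm : ∀ r ∈ Finset.Icc 1 R, 2 * x ^ 2 * (R : ℝ) ^ (1 - α) * r ≤
      periodicJ α m (r : ZMod (2 * m)) * (1 - ringCos (p * (r : ZMod (2 * m)))) := by
    intro r hr
    rw [Finset.mem_Icc] at hr
    have hr0 : (0 : ℝ) < r := by exact_mod_cast hr.1
    have hrR : (r : ℝ) ≤ R := by exact_mod_cast hr.2
    have hval : (r : ZMod (2 * m)).val = r := by
      rw [ZMod.val_natCast, Nat.mod_eq_of_lt (by omega)]
    have h1 := one_div_val_rpow_le_periodicJ hα₁ (r : ZMod (2 * m))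
    rw [hval] at h1
    have hxr : x * r ≤ 1 := by
      rw [hx, div_mul_eq_mul_div, div_le_one hm']
      have : k * r ≤ m := (Nat.mul_le_mul_left k hr.2).trans (by rwa [mul_comm])
      exact_mod_cast this
    have h2 : 2 * x ^ 2 * r ^ 2 ≤ 1 - ringCos (p * (r : ZMod (2 * m))) := by
      rw [ringCos_mul_natCast]
      have h3 := one_sub_cos_ge (x := Real.pi * x * r) (by positivity)
        (by rw [mul_assoc]; exact mul_le_of_le_one_right Real.pi_pos.le hxr)
      refine le_trans (le_of_eq ?_) h3
      have := Real.pi_ne_zero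
      field_simp
    have h4 : (R : ℝ) ^ (1 - α) ≤ (r : ℝ) ^ (1 - α) :=
      Real.rpow_le_rpow_of_nonpos hr0 hrR (by linarith)
    have h5 : (r : ℝ) ^ (1 - α) * r = 1 / (r : ℝ) ^ α * r ^ 2 := by
      rw [Real.rpow_sub hr0, Real.rpow_one]
      ring
    calc 2 * x ^ 2 * (R : ℝ) ^ (1 - α) * r ≤ 2 * x ^ 2 * (r : ℝ) ^ (1 - α) * r := by gcongr
      _ = 1 / (r : ℝ) ^ α * (2 * x ^ 2 * r ^ 2) := by rw [mul_assoc, h5]; ring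
      _ ≤ _ := mul_le_mul h1 h2 (by positivity) (periodicJ_nonneg _ _ _)
  have hinj : Set.InjOn (fun r : ℕ => (r : ZMod (2 * m))) (Finset.Icc 1 R : Finset ℕ) := by
    intro a ha b hb hab
    rw [Finset.mem_coe, Finset.mem_Icc] at ha hb
    simp only [ZMod.natCast_eq_natCast_iff'] at hab
    rwa [Nat.mod_eq_of_lt (by omega), Nat.mod_eq_of_lt (by omega)] at hab
  have hsub : (Finset.Icc 1 R).image (fun r : ℕ => (r : ZMod (2 * m))) ⊆ Finset.univ.erase 0 := by
    intro q hq
    obtain ⟨r, hr, rfl⟩ := Finset.mem_image.1 hq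
    rw [Finset.mem_Icc] at hr
    refine Finset.mem_erase.2 ⟨fun h => ?_, Finset.mem_univ _⟩
    rw [ZMod.natCast_eq_zero_iff] at h
    have := Nat.le_of_dvd (by omega) h
    omega
  have hgauss : (R : ℝ) ^ 2 / 2 ≤ ∑ r ∈ Finset.Icc 1 R, (r : ℝ) := by
    have h1 : ∀ n : ℕ, (n : ℝ) ^ 2 / 2 ≤ ∑ r ∈ Finset.Icc 1 n, (r : ℝ) := by
      intro n
      induction n with
      | zero => simp
      | succ n ih =>
        rw [Finset.sum_Icc_succ_top (by omega)]
        push_cast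
        linarith
    exact h1 R
  have hpow : (1 / 4) * x ^ (α - 1) ≤ x ^ 2 * ((R : ℝ) ^ (1 - α) * (R : ℝ) ^ 2) := by
    have h1 : (R : ℝ) ^ (1 - α) * (R : ℝ) ^ 2 = (R : ℝ) ^ (3 - α) := by
      rw [← Real.rpow_natCast (R : ℝ) 2, ← Real.rpow_add hR']
      congr 1
      push_cast
      ring
    have h2 : (1 / 2) * x⁻¹ ≤ (R : ℝ) := by
      have : (m : ℝ) ≤ 2 * R * k := by exact_mod_cast hR2
      rw [hx, inv_div, one_div_mul_eq_div, div_div, div_le_iff₀ (by positivity)]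
      linarith
    have h3 : ((1 / 2) * x⁻¹) ^ (3 - α) ≤ (R : ℝ) ^ (3 - α) :=
      Real.rpow_le_rpow (by positivity) h2 (by linarith)
    have h4 : (1 / 4 : ℝ) ≤ (1 / 2) ^ (3 - α) := by
      have : (1 / 2 : ℝ) ^ (2 : ℝ) ≤ (1 / 2) ^ (3 - α) :=
        Real.rpow_le_rpow_of_exponent_ge (by norm_num) (by norm_num) (by linarith)
      refine le_trans (le_of_eq ?_) this
      norm_num
    have h5 : x ^ (α - 1) = x ^ 2 * x⁻¹ ^ (3 - α) := by
      rw [Real.inv_rpow hx0.le, ← Real.rpow_neg hx0.le, ← Real.rpow_natCast x 2,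
        ← Real.rpow_add hx0]
      congr 1
      push_cast
      ring
    rw [h1, h5]
    rw [Real.mul_rpow (by norm_num) (by positivity)] at h3
    have h6 : 0 < x⁻¹ ^ (3 - α) := Real.rpow_pos_of_pos (by positivity) _
    calc 1 / 4 * (x ^ 2 * x⁻¹ ^ (3 - α)) = x ^ 2 * (1 / 4 * x⁻¹ ^ (3 - α)) := by ring
      _ ≤ x ^ 2 * ((1 / 2) ^ (3 - α) * x⁻¹ ^ (3 - α)) := by gcongr
      _ ≤ _ := by gcongr
  calc (1 / 4) * x ^ (α - 1) ≤ x ^ 2 * ((R : ℝ) ^ (1 - α) * (R : ℝ) ^ 2) := hpow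
    _ = 2 * x ^ 2 * (R : ℝ) ^ (1 - α) * ((R : ℝ) ^ 2 / 2) := by ring
    _ ≤ 2 * x ^ 2 * (R : ℝ) ^ (1 - α) * ∑ r ∈ Finset.Icc 1 R, (r : ℝ) := by gcongr
    _ ≤ ∑ r ∈ Finset.Icc 1 R,
        periodicJ α m (r : ZMod (2 * m)) * (1 - ringCos (p * (r : ZMod (2 * m)))) := by
      rw [Finset.mul_sum]
      exact Finset.sum_le_sum hterm
    _ = ∑ q ∈ (Finset.Icc 1 R).image (fun r : ℕ => (r : ZMod (2 * m))),
        periodicJ α m q * (1 - ringCos (p * q)) := 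
        (Finset.sum_image (f := fun q => periodicJ α m q * (1 - ringCos (p * q))) hinj).symm
    _ ≤ _ := Finset.sum_le_sum_of_subset_of_nonneg hsub fun q _ _ =>
      mul_nonneg (periodicJ_nonneg _ _ _) (by linarith [ringCos_le_one (p * q)])

/-- The quadratic term is the nearest-neighbour part, bounded by `1 - cos (π x) ≥ 2 x²` on `[0, 1]`.
-/
theorem le_dispersion {α γ ε : ℝ} (hα₁ : 1 < α) (hα₂ : α < 2) (hε : 0 ≤ ε) (hγ : ε ≤ γ)
    {m : ℕ} [NeZero m] {p : ZMod (2 * m)} (hp : p ≠ 0) :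
    ε / 4 * ((p.valMinAbs.natAbs : ℝ) / m) ^ (α - 1)
      + 4 * (γ - ε) * ((p.valMinAbs.natAbs : ℝ) / m) ^ 2 ≤
      dispersion (ringCoupling α γ ε m) p := by
  have hm' : (0 : ℝ) < m := Nat.cast_pos.2 (Nat.pos_of_ne_zero (NeZero.ne m))
  rw [dispersion_ringCoupling]
  have h1 := mul_le_mul_of_nonneg_left (le_sum_periodicJ_mul hα₁ hα₂ hp) hε
  have hx : (p.valMinAbs.natAbs : ℝ) / m ≤ 1 := by
    rw [div_le_one hm']
    have := ZMod.natAbs_valMinAbs_le p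
    exact_mod_cast (by omega : p.valMinAbs.natAbs ≤ m)
  have h2 : 2 * ((p.valMinAbs.natAbs : ℝ) / m) ^ 2 ≤ 1 - ringCos p := by
    have h3 := ringCos_mul_natCast p 1
    rw [Nat.cast_one, mul_one, Nat.cast_one, mul_one] at h3
    rw [h3]
    refine le_trans (le_of_eq ?_) (one_sub_cos_ge (by positivity)
      (mul_le_of_le_one_right Real.pi_pos.le hx))
    have := Real.pi_ne_zero
    field_simp
  have h4 := mul_le_mul_of_nonneg_left h2 (sub_nonneg.2 hγ)
  linarith

/-- Weighted AM–GM interpolates between `x^(α-1)`, whose reciprocal is integrable, and `(γ - ε) x²`,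
which grows with `γ`. The weight `θ = (2-α)/(2(3-α))` makes the resulting exponent `α/2 < 1`, so the
sum stays bounded in `m` while a positive power of `γ - ε` remains in the denominator. -/
theorem sum_one_div_dispersion_le {α γ ε : ℝ} (hα₁ : 1 < α) (hα₂ : α < 2) (hε : 0 < ε)
    (hγ : ε < γ) (m : ℕ) [NeZero m] :
    (∀ p : ZMod (2 * m), p ≠ 0 → 0 < dispersion (ringCoupling α γ ε m) p) ∧
    (1 / m) * ∑ p ∈ Finset.univ.erase 0, 1 / dispersion (ringCoupling α γ ε m) p ≤
      4 / (2 - α) / ((ε / 4) ^ (1 - (2 - α) / (2 * (3 - α))) *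
        (4 * (γ - ε)) ^ ((2 - α) / (2 * (3 - α)))) := by
  have hm' : (0 : ℝ) < m := Nat.cast_pos.2 (Nat.pos_of_ne_zero (NeZero.ne m))
  set θ := (2 - α) / (2 * (3 - α)) with hθ
  have h3α : 0 < 3 - α := by linarith
  have hθ0 : 0 ≤ θ := div_nonneg (by linarith) (by linarith)
  have hθ1 : θ ≤ 1 := by rw [hθ, div_le_one (by linarith)]; linarith
  have hg : 0 < 4 * (γ - ε) := by linarith
  set A := (ε / 4) ^ (1 - θ) * (4 * (γ - ε)) ^ θ with hA
  have hA0 : 0 < A := by positivity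
  have hE : ∀ p : ZMod (2 * m), p ≠ 0 → A * ((p.valMinAbs.natAbs : ℝ) / m) ^ (α / 2) ≤
      dispersion (ringCoupling α γ ε m) p := by
    intro p hp
    have hk0 : 0 < p.valMinAbs.natAbs := Int.natAbs_pos.2 (by rwa [Ne, ZMod.valMinAbs_eq_zero])
    have hk' : (0 : ℝ) < p.valMinAbs.natAbs := by exact_mod_cast hk0
    refine le_trans ?_ (le_dispersion hα₁ hα₂ hε.le hγ.le hp)
    set x := (p.valMinAbs.natAbs : ℝ) / m with hx
    have hx0 : 0 < x := by positivity
    have ha : 0 ≤ ε / 4 * x ^ (α - 1) := by positivity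
    have hb : 0 ≤ 4 * (γ - ε) * x ^ 2 := by positivity
    have h1 := Real.geom_mean_le_arith_mean2_weighted (sub_nonneg.2 hθ1) hθ0 ha hb (by ring)
    have h2 : A * x ^ (α / 2) = (ε / 4 * x ^ (α - 1)) ^ (1 - θ) * (4 * (γ - ε) * x ^ 2) ^ θ := by
      rw [Real.mul_rpow (by positivity) (by positivity), Real.mul_rpow hg.le (by positivity),
        ← Real.rpow_natCast x 2, ← Real.rpow_mul hx0.le, ← Real.rpow_mul hx0.le]
      have h3 : α / 2 = (α - 1) * (1 - θ) + (2 : ℕ) * θ := by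
        rw [hθ]
        push_cast
        field_simp
        ring
      rw [h3, Real.rpow_add hx0, hA]
      ring
    rw [h2]
    refine h1.trans (add_le_add ?_ ?_)
    · exact mul_le_of_le_one_left ha (by linarith)
    · exact mul_le_of_le_one_left hb hθ1
  have hpos : ∀ p : ZMod (2 * m), p ≠ 0 → 0 < A * ((p.valMinAbs.natAbs : ℝ) / m) ^ (α / 2) := by
    intro p hp
    have hk0 : 0 < p.valMinAbs.natAbs := Int.natAbs_pos.2 (by rwa [Ne, ZMod.valMinAbs_eq_zero])
    have hk' : (0 : ℝ) < p.valMinAbs.natAbs := by exact_mod_cast hk0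
    positivity
  refine ⟨fun p hp => (hpos p hp).trans_le (hE p hp), ?_⟩
  have hs : ∀ k : ℕ, 1 / (A * ((k : ℝ) / m) ^ (α / 2)) =
      (m : ℝ) ^ (α / 2) / A * (k : ℝ) ^ (-(α / 2)) := by
    intro k
    rw [Real.div_rpow (Nat.cast_nonneg _) hm'.le, Real.rpow_neg (Nat.cast_nonneg _)]
    have := (Real.rpow_pos_of_pos hm' (α / 2)).ne'
    -- At `k = 0` both sides are zero, since division by zero gives zero.
    rcases eq_or_ne ((k : ℝ) ^ (α / 2)) 0 with h | h
    · simp [h]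
    · field_simp
  have h1 : ∑ p ∈ Finset.univ.erase 0, 1 / dispersion (ringCoupling α γ ε m) p ≤
      2 * ((m : ℝ) ^ (α / 2) / A * ((m : ℝ) ^ (1 - α / 2) / (1 - α / 2))) := by
    calc ∑ p ∈ Finset.univ.erase 0, 1 / dispersion (ringCoupling α γ ε m) p
        ≤ ∑ p ∈ (Finset.univ : Finset (ZMod (2 * m))).erase 0,
          1 / (A * ((p.valMinAbs.natAbs : ℝ) / m) ^ (α / 2)) :=
          Finset.sum_le_sum fun p hp => one_div_le_one_div_of_le
            (hpos p (Finset.ne_of_mem_erase hp)) (hE p (Finset.ne_of_mem_erase hp))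
      _ ≤ 2 * ∑ k ∈ Finset.Icc 1 m, 1 / (A * ((k : ℝ) / m) ^ (α / 2)) :=
          sum_natAbs_valMinAbs_le (f := fun k => 1 / (A * ((k : ℝ) / m) ^ (α / 2)))
            fun k => by positivity
      _ ≤ _ := by
          simp only [hs, ← Finset.mul_sum]
          have := sum_rpow_neg_le (s := α / 2) (by linarith) (by linarith) m
          gcongr
  have h2 : (m : ℝ) ^ (α / 2) * (m : ℝ) ^ (1 - α / 2) = m := by
    rw [← Real.rpow_add hm', add_sub_cancel, Real.rpow_one]
  have h2α : 0 < 2 - α := by linarith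
  have h1α : 1 - α / 2 ≠ 0 := by linarith
  calc _ ≤ (1 / m) * (2 * ((m : ℝ) ^ (α / 2) / A * ((m : ℝ) ^ (1 - α / 2) / (1 - α / 2)))) := by
        gcongr
    _ = (1 / m) * (2 * ((m : ℝ) ^ (α / 2) * (m : ℝ) ^ (1 - α / 2) / (A * (1 - α / 2)))) := by
        rw [div_mul_div_comm]
    _ = 4 / (2 - α) / A := by
        rw [h2]
        have : 1 - α / 2 = (2 - α) / 2 := by ring
        rw [this]
        field_simp
        norm_num

/-- For strong nearest-neighbour coupling all two-point functions are at least `1 / 2`. -/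
theorem exists_half_le_gibbsExp {α : ℝ} (hα₁ : 1 < α) (hα₂ : α < 2) {ε : ℝ} (hε : 0 < ε) :
    ∃ γ₀ : ℝ, 0 < γ₀ ∧ ∀ γ : ℝ, γ₀ < γ → ∀ (m : ℕ) [NeZero m] (j k : ZMod (2 * m)),
      1 / 2 ≤ gibbsExp α γ ε m fun σ => spin (σ j) * spin (σ k) := by
  set θ := (2 - α) / (2 * (3 - α)) with hθ
  have hθ0 : 0 < θ := div_pos (by linarith) (by linarith)
  have h2α : 0 < 2 - α := by linarith
  have hlim : Tendsto (fun g : ℝ => (ε / 4) ^ (1 - θ) * (4 * g) ^ θ) atTop atTop :=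
    ((tendsto_rpow_atTop hθ0).comp (tendsto_id.const_mul_atTop four_pos)).const_mul_atTop
      (by positivity)
  -- The threshold `8 / (2 - α)` is what makes the bound `4 / (2 - α) / A` at most `1/2`.
  obtain ⟨g₀, hg₀⟩ := eventually_atTop.1 (hlim.eventually_ge_atTop (8 / (2 - α)))
  refine ⟨max g₀ 0 + ε, by positivity, fun γ hγ m _ j k => ?_⟩
  have hγε : ε < γ := by linarith [le_max_right g₀ 0]
  have hA := hg₀ (γ - ε) (by linarith [le_max_left g₀ 0])
  obtain ⟨hpos, hsum⟩ := sum_one_div_dispersion_le hα₁ hα₂ hε hγε m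
  have hW := gibbsSum_one_pos (ringCoupling α γ ε m)
  have h1 := le_gibbsSum_spin_mul_spin
    (reflectionPositive_ringCoupling hα₁ hε.le hγε.le m) hpos j k
  have h2 : 4 / (2 - α) / ((ε / 4) ^ (1 - θ) * (4 * (γ - ε)) ^ θ) ≤ 1 / 2 := by
    have h3 : 0 < 8 / (2 - α) := by positivity
    rw [div_le_iff₀ (h3.trans_le hA)]
    have : 8 / (2 - α) = 2 * (4 / (2 - α)) := by ring
    linarith
  rw [gibbsExp_eq_gibbsSum_div, le_div_iff₀ hW]
  refine le_trans (mul_le_mul_of_nonneg_right ?_ hW.le) h1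
  linarith

/-! ### Existence of infinite-volume limits -/

instance : DiscreteMeasurableSpace ℤˣ :=
  ⟨fun s => ⟨Units.val '' s, trivial, Set.preimage_image_eq s Units.val_injective⟩⟩

theorem continuous_spin : Continuous spin := continuous_of_discreteTopology

/-- The finite-volume Gibbs measure on the ring, unrolled to a measure on configurations on `ℤ`. -/
def periodicGibbs (α γ ε : ℝ) (m : ℕ) [NeZero m] : Measure (ℤ → ℤˣ) :=
  ∑ σ : ZMod (2 * m) → ℤˣ, ENNReal.ofReal (Real.exp (-hamiltonian α γ ε m σ) /
    ∑ τ, Real.exp (-hamiltonian α γ ε m τ)) • Measure.dirac fun i : ℤ => σ (i : ZMod (2 * m))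

theorem partition_pos (α γ ε : ℝ) (m : ℕ) [NeZero m] :
    0 < ∑ τ, Real.exp (-hamiltonian α γ ε m τ) :=
  Finset.sum_pos (fun _ _ => Real.exp_pos _) Finset.univ_nonempty

instance (α γ ε : ℝ) (m : ℕ) [NeZero m] : IsProbabilityMeasure (periodicGibbs α γ ε m) := by
  have hZ := partition_pos α γ ε m
  constructor
  simp only [periodicGibbs, Measure.coe_finsetSum, Finset.sum_apply, Measure.smul_apply,
    measure_univ, smul_eq_mul, mul_one]
  rw [← ENNReal.ofReal_sum_of_nonneg fun σ _ => by positivity, ← Finset.sum_div,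
    div_self hZ.ne', ENNReal.ofReal_one]

theorem integral_periodicGibbs (α γ ε : ℝ) (m : ℕ) [NeZero m]
    {f : (ℤ → ℤˣ) → ℝ} (hf : Continuous f) :
    ∫ ω, f ω ∂periodicGibbs α γ ε m =
      gibbsExp α γ ε m fun σ => f fun i : ℤ => σ (i : ZMod (2 * m)) := by
  have hZ := partition_pos α γ ε m
  have hint : ∀ ω, Integrable f (Measure.dirac ω) := fun ω =>
    (BoundedContinuousFunction.mkOfCompact ⟨f, hf⟩).integrable _
  rw [periodicGibbs, integral_finsetSum_measure fun σ _ =>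
    (hint _).smul_measure ENNReal.ofReal_ne_top]
  rw [gibbsExp, Finset.sum_div]
  refine Finset.sum_congr rfl fun σ _ => ?_
  rw [integral_smul_measure, integral_dirac, ENNReal.toReal_ofReal (by positivity), smul_eq_mul]
  ring

/-- Probability measures on the compact space of configurations are sequentially compact, and spin
monomials are continuous. Rings are indexed by `l + 1` to avoid the empty size. -/
theorem exists_isPeriodicLimit (α γ ε : ℝ) :
    ∃ μ : Measure (ℤ → ℤˣ), IsProbabilityMeasure μ ∧ IsPeriodicLimit α γ ε μ := by
  let u : ℕ → ProbabilityMeasure (ℤ → ℤˣ) := fun l => ⟨periodicGibbs α γ ε (l + 1), inferInstance⟩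
  obtain ⟨μ, ψ, hψ, hlim⟩ := CompactSpace.tendsto_subseq u
  refine ⟨μ, inferInstance, fun l => ψ l + 1, fun l => ⟨Nat.succ_ne_zero _⟩,
    fun a b hab => Nat.succ_lt_succ (hψ hab), fun A => ?_⟩
  rw [ProbabilityMeasure.tendsto_iff_forall_integral_tendsto] at hlim
  have hc : Continuous fun ω : ℤ → ℤˣ => ∏ i ∈ A, spin (ω i) :=
    continuous_finsetProd _ fun i _ => continuous_spin.comp (continuous_apply i)
  have h := hlim (BoundedContinuousFunction.mkOfCompact ⟨_, hc⟩)
  refine h.congr fun l => ?_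
  exact integral_periodicGibbs α γ ε (ψ l + 1) hc

/-! ### From the uniform two-point bound to long-range order -/

/-- The squared magnetization density is the average of the two-point function over all pairs,
diagonal included. -/
theorem le_orderParameter {α γ ε c : ℝ} {m : ℕ} [NeZero m]
    (h : ∀ j k : ZMod (2 * m), c ≤ gibbsExp α γ ε m fun σ => spin (σ j) * spin (σ k)) :
    c ≤ orderParameter α γ ε m := by
  have hm : (0 : ℝ) < m := Nat.cast_pos.2 (Nat.pos_of_ne_zero (NeZero.ne m))
  have e : orderParameter α γ ε m = (1 / (2 * (m : ℝ))) ^ 2 *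
      ∑ j, ∑ k, gibbsExp α γ ε m fun σ => spin (σ j) * spin (σ k) := by
    simp only [orderParameter, gibbsExp_eq_gibbsSum_div, mul_pow, gibbsSum_const_mul]
    simp only [sq (∑ j, _), Finset.sum_mul_sum, gibbsSum_sum, Finset.sum_div, mul_div_assoc]
  rw [e]
  have h1 : (2 * m : ℝ) * ((2 * m) * c) ≤
      ∑ j : ZMod (2 * m), ∑ k, gibbsExp α γ ε m fun σ => spin (σ j) * spin (σ k) := by
    calc (2 * m : ℝ) * ((2 * m) * c) = ∑ _j : ZMod (2 * m), ∑ _k : ZMod (2 * m), c := by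
          simp [ZMod.card]
      _ ≤ _ := Finset.sum_le_sum fun j _ => Finset.sum_le_sum fun k _ => h j k
  calc c = (1 / (2 * (m : ℝ))) ^ 2 * ((2 * m : ℝ) * ((2 * m) * c)) := by field_simp
    _ ≤ _ := by gcongr

theorem le_integral_spin_mul_spin {α γ ε c : ℝ} {μ : Measure (ℤ → ℤˣ)}
    (hμ : IsPeriodicLimit α γ ε μ)
    (h : ∀ (m : ℕ) [NeZero m] (j k : ZMod (2 * m)),
      c ≤ gibbsExp α γ ε m fun σ => spin (σ j) * spin (σ k)) {i j : ℤ} (hij : i ≠ j) :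
    c ≤ ∫ ω, spin (ω i) * spin (ω j) ∂μ := by
  obtain ⟨φ, hφ, -, hlim⟩ := hμ
  have h1 := hlim {i, j}
  simp only [Finset.prod_pair hij] at h1
  exact ge_of_tendsto' h1 fun l => h (φ l) _ _

theorem exists_hasLongRangeOrder {α : ℝ} (hα₁ : 1 < α) (hα₂ : α < 2) {ε : ℝ} (hε : 0 < ε) :
    ∃ γ₀ : ℝ, 0 < γ₀ ∧ ∀ γ : ℝ, γ₀ < γ → HasLongRangeOrder α γ ε := by
  obtain ⟨γ₀, hγ₀, h⟩ := exists_half_le_gibbsExp hα₁ hα₂ hε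
  -- The bound holds on every ring, so `m₀ = 0` works; `N₀ = 1` only excludes the empty average.
  refine ⟨γ₀, hγ₀, fun γ hγ => ⟨1 / 2, by norm_num, ⟨0, fun m _ _ => le_orderParameter (h γ hγ m)⟩,
    exists_isPeriodicLimit α γ ε, fun μ _ hlim => ⟨1, fun N hN => ?_⟩⟩⟩
  have hN' : (0 : ℝ) < N := by exact_mod_cast hN
  have h1 : (N : ℝ) * (1 / 2) ≤ ∑ n ∈ Finset.Icc 1 N, ∫ ω, spin (ω 0) * spin (ω (n : ℤ)) ∂μ := by
    calc (N : ℝ) * (1 / 2) = ∑ _n ∈ Finset.Icc 1 N, (1 / 2 : ℝ) := by simp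
      _ ≤ _ := Finset.sum_le_sum fun n hn => le_integral_spin_mul_spin hlim (h γ hγ) (by
          have := (Finset.mem_Icc.1 hn).1
          omega)
  calc (1 / 2 : ℝ) = (1 / (N : ℝ)) * (N * (1 / 2)) := by field_simp
    _ ≤ _ := by gcongr

end

end DysonIsing

theorem mainTheorem4 (α : ℝ) (hα₁ : 1 < α) (hα₂ : α < 2) (ε : ℝ) (hε : 0 < ε) :
    ∃ γ₀ : ℝ, 0 < γ₀ ∧ ∀ γ : ℝ, γ₀ < γ → DysonIsing.HasLongRangeOrder α γ ε :=
  DysonIsing.exists_hasLongRangeOrder hα₁ hα₂ hε
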